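/- **Proposition (Fluid limit).** Let $D\ge 0$ and let $p_0,\dots,p_D\ge 0$ with $\sum_j p_j=1$; put $\lambda=\sum_j jp_j$. For every $N$ let vertices $1,\dots,N$ with degrees $\deg_N(i)\in\{0,\dots,D\}$ be given such that $\frac1N\#\{i:\deg_N(i)=j\}\to p_j$ for each $j$; vertex $i$ carries $\deg_N(i)$ half-edges. Run the following algorithm. Initially all vertices are empty and all half-edges are unpaired. At each step a vertex $v$ is chosen uniformly among the empty vertices and is moved to the independent set; then each half-edge of $v$ that is still unpaired is, in turn, paired with a uniformly chosen other unpaired half-edge (possibly one of $v$; it stays unpaired if no other unpaired half-edge exists), and the empty vertices reached in this way become blocked. When no empty vertex is left, the configuration does not change any more. Let $S^N_n$ be the size of the independent set, $U^N_n$ the number of unpaired half-edges and $E^N_n(j)$ the number of empty vertices of degree $j$ after $n$ steps, and let $X^N_t=\frac1N\bigl(S^N_{\lfloor Nt\rfloor},U^N_{\lfloor Nt\rfloor},E^N_{\lfloor Nt\rfloor}(0),\dots,E^N_{\lfloor Nt\rfloor}(D)\bigr)$, $t\in[0,1]$. The processes for the different $N$ are defined on one probability space, with an arbitrary joint law. Then,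 almost surely, $X^N\to\hat x$ uniformly on $[0,1]$ as $N\to\infty$. Here $\hat x=(s,u,e_0,\dots,e_D)$ is a deterministic continuous path on $[0,1]$ with $\hat x(0)=(0,\lambda,p_0,\dots,p_D)$, with values in $$E=\Bigl\{(s,u,e)\in[0,1]\times\mathbb R\times[0,1]^{D+1}:\ \sum_j je_j\le u\le\lambda\Bigr\},$$ and it is the unique continuous path with this initial value that has the following properties: the extinction times $t_i=\min\{t\in[0,1]:e_i(t)\le 0\}$ $(0\le i\le D)$ and $T^*=\min\{t\in[0,1]:\sum_k e_k(t)=0\}$ exist; $$\dot s=1,\qquad \dot u=\frac{-2\sum_k ke_k}{\sum_k e_k}\qquad\text{on }[0,T^*);$$ for every $i$, $$\dot e_i=\frac{-e_i-\frac{ie_i}{u}\sum_k ke_k}{\sum_k e_k}\quad\text{on }[0,t_i),\qquad e_i=0\quad\text{on }[t_i,1];$$ and the path is stopped at $T^*$, that is, $\hat x(t)=\hat x(T^*)=(T^*,u(T^*),0,\dots,0)$ for $t\ge T^*$. Moreover $T^*=\max_{0\le i\le D}t_i$. If $\lambda>0$, then also $T^*=\max_{1\le i\le D}t_i$, and $u>0$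 on $[0,T^*)$. If $\lambda=0$, then $u\equiv0$ and the term $ie_i/u$ is read as $0$. -/

import Mathlib

open Filter Topology MeasureTheory

namespace GreedyExploration

/-! ### The exploration algorithm -/

/-- The half-edges of the vertex set `Fin N` with prescribed degrees. -/
abbrev HalfEdge {N : ℕ} (deg : Fin N → ℕ) : Type := Σ i : Fin N, Fin (deg i)

/-- A configuration of the algorithm: the vertices already put into the independent set, the
empty vertices, and the half-edges that are still unpaired.  The blocked vertices are those in
neither `indep` nor `empty`. -/
@[ext]
structure Config {N : ℕ} (deg : Fin N → ℕ) where
  indep : Finset (Fin N)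
  empty : Finset (Fin N)
  unpaired : Finset (HalfEdge deg)

namespace Config

variable {N : ℕ} {deg : Fin N → ℕ}

/-- At step `0` all vertices are empty and all half-edges are unpaired. -/
def initial (deg : Fin N → ℕ) : Config deg where
  indep := ∅
  empty := Finset.univ
  unpaired := Finset.univ

/-- The vertex `v` is moved from the empty vertices to the independent set. -/
def select (c : Config deg) (v : Fin N) : Config deg where
  indep := insert v c.indep
  empty := c.empty.erase v
  unpaired := c.unpaired

/-- The half-edges `h` and `g` are paired.  If the vertex of `g` was empty, it becomes blocked. -/
def pair (c : Config deg) (h g : HalfEdge deg) : Config deg where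
  indep := c.indep
  empty := c.empty.erase g.1
  unpaired := (c.unpaired.erase h).erase g

/-- If `h` is unpaired, pair it with a uniformly chosen other unpaired half-edge.  Nothing happens
if `h` is already paired, or if there is no other unpaired half-edge. -/
noncomputable def pairOne (c : Config deg) (h : HalfEdge deg) : PMF (Config deg) :=
  if H : h ∈ c.unpaired ∧ (c.unpaired.erase h).Nonempty then
    (PMF.uniformOfFinset (c.unpaired.erase h) H.2).map (c.pair h)
  else PMF.pure c

/-- Pair the half-edges of a list, one after the other. -/
noncomputable def pairList : List (HalfEdge deg) → Config deg → PMF (Config deg)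
  | [], c => PMF.pure c
  | h :: l, c => (c.pairOne h).bind (pairList l)

/-- The list of the half-edges of `v`. -/
def halfEdges (deg : Fin N → ℕ) (v : Fin N) : List (HalfEdge deg) :=
  (List.finRange (deg v)).map fun a => ⟨v, a⟩

/-- One step of the algorithm: a uniformly chosen empty vertex is put into the independent set and
its half-edges are paired in turn.  When there is no empty vertex the algorithm has terminated and
the configuration no longer changes. -/
noncomputable def step (c : Config deg) : PMF (Config deg) :=
  if H : c.empty.Nonempty then
    (PMF.uniformOfFinset c.empty H).bind fun v => pairList (halfEdges deg v) (c.select v)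
  else PMF.pure c

end Config

/-- `ξ` is a run of the algorithm: a Markov chain started from the initial configuration, with
transition probabilities `Config.step`. -/
structure IsExploration {Ω : Type*} [MeasurableSpace Ω] (P : Measure Ω) {N : ℕ} {deg : Fin N → ℕ}
    (ξ : ℕ → Ω → Config deg) : Prop where
  measurable : ∀ n c, MeasurableSet (ξ n ⁻¹' {c})
  law : ∀ (n : ℕ) (c : ℕ → Config deg),
    P {ω | ∀ m ≤ n, ξ m ω = c m} =
      PMF.pure (Config.initial deg) (c 0) * ∏ m ∈ Finset.range n, (c m).step (c (m + 1))

/-- The space of points `(s, u, (e₀, …, e_D))`. -/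
abbrev State (D : ℕ) : Type := ℝ × ℝ × (Fin (D + 1) → ℝ)

/-- The rescaled triple `N⁻¹ (S, U, E(0), …, E(D))` of a configuration. -/
noncomputable def rescaled (D : ℕ) {N : ℕ} {deg : Fin N → ℕ} (c : Config deg) : State D :=
  ((c.indep.card : ℝ) / N, (c.unpaired.card : ℝ) / N,
    fun j => ((c.empty.filter fun i => deg i = (j : ℕ)).card : ℝ) / N)

/-- The rescaled process `X^N_t = N⁻¹ X^N_{[N t]}`. -/
noncomputable def rescaledProcess (D : ℕ) {Ω : Type*} {N : ℕ} {deg : Fin N → ℕ}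
    (ξ : ℕ → Ω → Config deg) (t : ℝ) (ω : Ω) : State D :=
  rescaled D (ξ ⌊(N : ℝ) * t⌋₊ ω)

/-! ### The fluid limit -/

/-- `∑ₖ k eₖ`. -/
noncomputable def halfEdgeMass {D : ℕ} (e : Fin (D + 1) → ℝ) : ℝ :=
  ∑ k : Fin (D + 1), ((k : ℕ) : ℝ) * e k

/-- The right-hand side of the equation for `u`. -/
noncomputable def uRate {D : ℕ} (e : Fin (D + 1) → ℝ) : ℝ :=
  -2 * halfEdgeMass e / ∑ k, e k

/-- The right-hand side of the equation for `eᵢ`. -/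
noncomputable def eRate {D : ℕ} (u : ℝ) (e : Fin (D + 1) → ℝ) (i : Fin (D + 1)) : ℝ :=
  (-e i - ((i : ℕ) : ℝ) * e i / u * halfEdgeMass e) / ∑ k, e k

/-- The compact set `E` of admissible states, where `l` is the mean degree. -/
def stateSpace (D : ℕ) (l : ℝ) : Set (State D) :=
  {x | x.1 ∈ Set.Icc 0 1 ∧ (∀ i, x.2.2 i ∈ Set.Icc 0 1) ∧ halfEdgeMass x.2.2 ≤ x.2.1 ∧ x.2.1 ≤ l}

/-- `x = (s, u, e)` is the path on `[0, 1]` obtained from the fluid equation with initial value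
`(0, ∑ k pₖ, p)` by freezing each `eᵢ` at `0` from its extinction time `t i` on, and by stopping
the path at the first time `T` at which all the `eᵢ` vanish. -/
structure IsFluidPath {D : ℕ} (p : Fin (D + 1) → ℝ) (x : ℝ → State D) (t : Fin (D + 1) → ℝ)
    (T : ℝ) : Prop where
  init : x 0 = (0, halfEdgeMass p, p)
  cont : ContinuousOn x (Set.Icc 0 1)
  extinction : ∀ i, IsLeast {r | r ∈ Set.Icc (0 : ℝ) 1 ∧ (x r).2.2 i ≤ 0} (t i)
  terminal : IsLeast {r | r ∈ Set.Icc (0 : ℝ) 1 ∧ ∑ k, (x r).2.2 k = 0} T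
  s_ode : ∀ r ∈ Set.Ico 0 T, HasDerivWithinAt (fun q => (x q).1) 1 (Set.Icc 0 1) r
  u_ode : ∀ r ∈ Set.Ico 0 T,
    HasDerivWithinAt (fun q => (x q).2.1) (uRate (x r).2.2) (Set.Icc 0 1) r
  e_ode : ∀ i, ∀ r ∈ Set.Ico 0 (t i),
    HasDerivWithinAt (fun q => (x q).2.2 i) (eRate (x r).2.1 (x r).2.2 i) (Set.Icc 0 1) r
  e_frozen : ∀ i, ∀ r ∈ Set.Icc (t i) 1, (x r).2.2 i = 0
  stopped : ∀ r ∈ Set.Icc T 1, x r = x T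

end GreedyExploration

/-!
The limit path is explicit.  Measure time by the probability `φ` that an empty vertex which cannot be
blocked has already been selected, and let `θ` be the probability that a half-edge of an empty vertex
has not been hit.  Then `eᵢ = pᵢ (1 - φ) θⁱ` and `u = λ θ²`, where `θ' = -ĝ(θ)` and `ĝ` is the
generating function of the size-biased degree distribution.  As `ĝ ≤ 1` on `[0, 1]`, this gives
`θ ≥ 1 - φ` (`exists_survival`), so that the equation is regular for `φ < 1` and all degrees with
`pᵢ > 0` die out at the same moment `φ = 1`.  Real time is the integral of `∑ₖ pₖ θᵏ`; inverting it
(`exists_timeChange`) yields the path (`exists_fluidPath`).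

Uniqueness (`IsFluidPath.unique`) only needs that the explicit path stays in the open set `regular D`
before `T`, where the vector field is locally Lipschitz: any other path agrees with it for a short
while after every time up to which they agree.  For `λ = 0` every path is computed directly.

For the convergence, one step of the algorithm changes the integer state on average by the fluid
vector field up to an error `O(1 / U)` (`abs_expect_step_unpaired_le` and
`abs_expect_step_emptyOfDeg_le`), because all half-edges of an empty vertex are unpaired and half-edges
of the selected vertex are paired with each other with probability `O(1 / U)` only.  The centred
increments are bounded, so their sums over at most `N` steps exceed `ε N` with a probability
exponentially small in `N`; by the Borel–Cantelli lemma they are almost surely `o(N)`, whatever the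
joint law for the different `N` (`ae_eventually_abs_noise_le`).

The rest is deterministic.  A discrete Grönwall estimate (`eventually_norm_sub_le_of_increments`)
keeps the rescaled process close to the path up to any time `T₁ < T`.  At a time `T₁` close to `T` few
empty vertices are left; as the numbers of empty vertices and of unpaired half-edges never increase,
all later changes are bounded by the number of empty vertices at `T₁`
(`Config.IsTrajectory.norm_count_sub_le`).  If `λ = 0`, there are only `o(N)` half-edges, and the
process follows the path `(r, 0, 1 - r, 0, …, 0)` by counting.
-/

namespace GreedyExploration

/-! ### The explicit solution -/

/-- The generating function `∑ₖ pₖ zᵏ` of the degree distribution. -/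
noncomputable def genFun {D : ℕ} (p : Fin (D + 1) → ℝ) (z : ℝ) : ℝ :=
  ∑ k, p k * z ^ (k : ℕ)

/-- The generating function `∑ₖ k pₖ zᵏ⁻¹ / ∑ₖ k pₖ` of the size-biased degree distribution,
shifted by one.  It is `0` when the mean degree vanishes. -/
noncomputable def sizeBiasFun {D : ℕ} (p : Fin (D + 1) → ℝ) (z : ℝ) : ℝ :=
  (∑ k : Fin (D + 1), ((k : ℕ) : ℝ) * p k * z ^ ((k : ℕ) - 1)) / halfEdgeMass p

section

variable {D : ℕ} {p : Fin (D + 1) → ℝ}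

lemma halfEdgeMass_nonneg {e : Fin (D + 1) → ℝ} (he : ∀ j, 0 ≤ e j) : 0 ≤ halfEdgeMass e :=
  Finset.sum_nonneg fun k _ => mul_nonneg (Nat.cast_nonneg _) (he k)

lemma continuous_genFun : Continuous (genFun p) := by
  unfold genFun; fun_prop

lemma contDiff_sizeBiasFun : ContDiff ℝ 1 (sizeBiasFun p) := by
  unfold sizeBiasFun; fun_prop

lemma genFun_one (hp_sum : ∑ j, p j = 1) : genFun p 1 = 1 := by simp [genFun, hp_sum]

lemma genFun_nonneg (hp : ∀ j, 0 ≤ p j) {z : ℝ} (hz : 0 ≤ z) : 0 ≤ genFun p z :=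
  Finset.sum_nonneg fun k _ => mul_nonneg (hp k) (pow_nonneg hz _)

lemma genFun_pos (hp : ∀ j, 0 ≤ p j) (hp_sum : ∑ j, p j = 1) {z : ℝ} (hz : 0 < z) :
    0 < genFun p z := by
  obtain ⟨j, -, hj⟩ : ∃ j ∈ Finset.univ, p j ≠ 0 := by
    apply Finset.exists_ne_zero_of_sum_ne_zero; rw [hp_sum]; norm_num
  exact Finset.sum_pos' (fun k _ => mul_nonneg (hp k) (pow_nonneg hz.le _))
    ⟨j, Finset.mem_univ _, mul_pos (lt_of_le_of_ne (hp j) hj.symm) (pow_pos hz _)⟩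

lemma genFun_le_one (hp : ∀ j, 0 ≤ p j) (hp_sum : ∑ j, p j = 1) {z : ℝ} (hz : 0 ≤ z)
    (hz1 : z ≤ 1) : genFun p z ≤ 1 := by
  rw [← hp_sum]
  exact Finset.sum_le_sum fun k _ => mul_le_of_le_one_right (hp k) (pow_le_one₀ hz hz1)

lemma sizeBiasFun_nonneg (hp : ∀ j, 0 ≤ p j) {z : ℝ} (hz : 0 ≤ z) : 0 ≤ sizeBiasFun p z :=
  div_nonneg (Finset.sum_nonneg fun k _ => by have := hp k; positivity) (halfEdgeMass_nonneg hp)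

lemma sizeBiasFun_le_one (hp : ∀ j, 0 ≤ p j) {z : ℝ} (hz : 0 ≤ z) (hz1 : z ≤ 1) :
    sizeBiasFun p z ≤ 1 := by
  refine div_le_one_of_le₀ ?_ (halfEdgeMass_nonneg hp)
  exact Finset.sum_le_sum fun k _ => mul_le_of_le_one_right
    (mul_nonneg (Nat.cast_nonneg _) (hp k)) (pow_le_one₀ hz hz1)

/-- The identity behind the explicit solution: `∑ₖ k eₖ = (1 - φ) θ λ ĝ(θ)` for
`eₖ = pₖ (1 - φ) θᵏ`, where `ĝ` is `sizeBiasFun p`. -/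
lemma halfEdgeMass_explicit (hp : ∀ j, 0 ≤ p j) (a z : ℝ) :
    halfEdgeMass (fun i : Fin (D + 1) => p i * a * z ^ (i : ℕ))
      = a * z * (halfEdgeMass p * sizeBiasFun p z) := by
  have key : halfEdgeMass p * sizeBiasFun p z
      = ∑ k : Fin (D + 1), ((k : ℕ) : ℝ) * p k * z ^ ((k : ℕ) - 1) := by
    unfold sizeBiasFun
    by_cases h : halfEdgeMass p = 0
    · rw [h, zero_mul]
      refine (Finset.sum_eq_zero fun k _ => ?_).symm
      have := (Finset.sum_eq_zero_iff_of_nonneg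
        (fun k _ => mul_nonneg (Nat.cast_nonneg _) (hp k))).1 h k (Finset.mem_univ _)
      rw [this, zero_mul]
    · field_simp
  rw [key, halfEdgeMass, Finset.mul_sum]
  refine Finset.sum_congr rfl fun k _ => ?_
  rcases Nat.eq_zero_or_pos (k : ℕ) with h | h
  · simp [h]
  · obtain ⟨m, hm⟩ := Nat.exists_eq_succ_of_ne_zero h.ne'
    rw [hm, Nat.succ_sub_one, pow_succ]; ring

/-- The clock of the explicit solution.  In the time scale `φ` in which an isolated empty vertex
survives with probability `1 - φ`, a half-edge of an empty vertex has not yet been hit with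
probability `θ φ`, where `θ' = - ĝ(θ)`.  Since `ĝ ≤ 1`, this probability is at least `1 - φ`. -/
lemma exists_survival (hp : ∀ j, 0 ≤ p j) :
    ∃ θ : ℝ → ℝ, Continuous θ ∧ θ 0 = 1 ∧
      (∀ φ ∈ Set.Ico (0 : ℝ) 1, HasDerivAt θ (-sizeBiasFun p (θ φ)) φ) ∧
      ∀ φ ∈ Set.Icc (0 : ℝ) 1, 1 - φ ≤ θ φ ∧ θ φ ≤ 1 := by
  -- Clamping the argument to `[0, 1]` makes the vector field globally Lipschitz and bounded by `1`.
  let c : ℝ → ℝ := fun z => max 0 (min 1 z)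
  have hc : ∀ z, c z ∈ Set.Icc (0 : ℝ) 1 := fun z =>
    ⟨le_max_left _ _, max_le zero_le_one (min_le_left _ _)⟩
  have hcl : LipschitzWith 1 c := (LipschitzWith.id.const_min 1).const_max 0
  obtain ⟨K, hK⟩ := contDiff_sizeBiasFun.locallyLipschitz.locallyLipschitzOn
    |>.exists_lipschitzOnWith_of_compact (f := sizeBiasFun p) (isCompact_Icc (a := (0 : ℝ)) (b := 1))
  have hF : LipschitzWith (K * 1) fun z => -sizeBiasFun p (c z) := by
    have := (hK.comp hcl.lipschitzOnWith (s := Set.univ) fun z _ => hc z)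
    rw [lipschitzOnWith_univ] at this
    exact this.neg
  have hPL : IsPicardLindelof (fun (_ : ℝ) z => -sizeBiasFun p (c z))
      (⟨0, by norm_num⟩ : Set.Icc (-1 : ℝ) 1) 1 1 0 1 (K * 1) :=
    { lipschitzOnWith := fun _ _ => hF.lipschitzOnWith
      continuousOn := fun _ _ => continuousOn_const
      norm_le := fun _ _ z _ => by
        rw [norm_neg, Real.norm_eq_abs, abs_of_nonneg (sizeBiasFun_nonneg hp (hc z).1)]
        exact sizeBiasFun_le_one hp (hc z).1 (hc z).2
      mul_max_le := by norm_num }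
  obtain ⟨θ, h0, hθ⟩ := hPL.exists_eq_forall_mem_Icc_hasDerivWithinAt₀
  simp only at h0 hθ
  have hθc : ContinuousOn θ (Set.Icc (-1) 1) := fun φ hφ => (hθ φ hφ).continuousWithinAt
  have hd : ∀ φ ∈ Set.Ioo (-1 : ℝ) 1, HasDerivAt θ (-sizeBiasFun p (c (θ φ))) φ := fun φ hφ =>
    (hθ φ ⟨hφ.1.le, hφ.2.le⟩).hasDerivAt (Icc_mem_nhds hφ.1 hφ.2)
  have hsub : Set.Icc (0 : ℝ) 1 ⊆ Set.Icc (-1) 1 := Set.Icc_subset_Icc (by norm_num) le_rfl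
  have hbound : ∀ φ ∈ Set.Icc (0 : ℝ) 1, 1 - φ ≤ θ φ ∧ θ φ ≤ 1 := by
    intro φ hφ
    have hint : ∀ y ∈ interior (Set.Icc (0 : ℝ) 1), HasDerivAt θ (-sizeBiasFun p (c (θ y))) y := by
      intro y hy
      rw [interior_Icc] at hy
      exact hd y ⟨by linarith [hy.1], hy.2⟩
    have hanti : AntitoneOn θ (Set.Icc 0 1) := by
      refine antitoneOn_of_hasDerivWithinAt_nonpos (convex_Icc 0 1) (hθc.mono hsub)
        (fun y hy => (hint y hy).hasDerivWithinAt) fun y _ => ?_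
      linarith [sizeBiasFun_nonneg hp (hc (θ y)).1]
    have hmono : MonotoneOn (fun y => θ y + y) (Set.Icc 0 1) := by
      refine monotoneOn_of_hasDerivWithinAt_nonneg (convex_Icc 0 1)
        ((hθc.mono hsub).add continuousOn_id)
        (fun y hy => ((hint y hy).add (hasDerivAt_id y)).hasDerivWithinAt) fun y _ => ?_
      linarith [sizeBiasFun_le_one hp (hc (θ y)).1 (hc (θ y)).2]
    have h0m : (0 : ℝ) ∈ Set.Icc (0 : ℝ) 1 := by norm_num
    have h1 := hanti h0m hφ hφ.1
    have h2 := hmono h0m hφ hφ.1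
    simp only [h0] at h1 h2
    constructor <;> linarith
  let i : ℝ → ℝ := fun φ => max (-1) (min 1 φ)
  have hi : ∀ φ ∈ Set.Icc (-1 : ℝ) 1, i φ = φ := fun φ hφ => by
    simp [i, hφ.1, hφ.2]
  have hieq : ∀ φ ∈ Set.Icc (0 : ℝ) 1, i φ = φ := fun φ hφ => hi φ (hsub hφ)
  refine ⟨θ ∘ i, ?_, ?_, ?_, ?_⟩
  · refine hθc.comp_continuous (by fun_prop) fun φ =>
      ⟨le_max_left _ _, max_le (by norm_num) (min_le_left _ _)⟩
  · simp [hieq 0 (by norm_num), h0]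
  · intro φ hφ
    have hφ' : φ ∈ Set.Icc (0 : ℝ) 1 := ⟨hφ.1, hφ.2.le⟩
    have hcθ : c (θ φ) = θ φ := by
      have := hbound φ hφ'
      have h0 : 0 ≤ θ φ := by linarith [hφ.2]
      simp [c, this.2, h0]
    have := hd φ ⟨by linarith [hφ.1], hφ.2⟩
    rw [hcθ] at this
    simp only [Function.comp, hieq φ hφ']
    refine this.congr_of_eventuallyEq ?_
    filter_upwards [Icc_mem_nhds (show (-1 : ℝ) < φ by linarith [hφ.1]) hφ.2] with y hy
    simp [hi y hy]
  · intro φ hφ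
    simpa [hieq φ hφ] using hbound φ hφ

/-- A time change with speed `H`, inverted.  The clock `∫₀^φ H` may be stationary from `φ = 1` on;
adding `φ - 1` there makes it a bijection of `ℝ`. -/
lemma exists_timeChange {H : ℝ → ℝ} (hc : Continuous H) (hpos : ∀ φ < 1, 0 < H φ)
    (hle : ∀ φ, 1 ≤ φ → 0 ≤ H φ) (hone : ∀ φ ≤ 0, H φ = 1) (hH1 : ∀ φ, H φ ≤ 1) :
    ∃ (ψ : ℝ → ℝ) (T : ℝ), 0 < T ∧ T ≤ 1 ∧ Continuous ψ ∧ StrictMono ψ ∧ ψ 0 = 0 ∧ ψ T = 1 ∧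
      ∀ r < T, HasDerivAt ψ (H (ψ r))⁻¹ r := by
  let I : ℝ → ℝ := fun φ => ∫ q in (0 : ℝ)..φ, H q
  have hI : ∀ φ, HasDerivAt I (H φ) φ := fun φ => hc.integral_hasStrictDerivAt 0 φ |>.hasDerivAt
  have hIc : Continuous I := continuous_iff_continuousAt.2 fun φ => (hI φ).continuousAt
  let τ : ℝ → ℝ := fun φ => I φ + max (φ - 1) 0
  have hτc : Continuous τ := by fun_prop
  have hτd : ∀ φ < 1, HasDerivAt τ (H φ) φ := by
    intro φ hφ
    refine (hI φ).congr_of_eventuallyEq ?_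
    filter_upwards [Iio_mem_nhds hφ] with y hy
    have : max (y - 1) 0 = 0 := max_eq_right (by linarith [Set.mem_Iio.1 hy])
    simp [τ, this]
  have hIpos : ∀ φ, 0 ≤ H φ := fun φ => by
    rcases lt_or_ge φ 1 with h | h
    exacts [(hpos φ h).le, hle φ h]
  have hImono : Monotone I := monotone_of_hasDerivAt_nonneg hI hIpos
  have hmono : StrictMono τ := by
    refine StrictMonoOn.Iic_union_Ici (a := 1) ?_ ?_
    · refine strictMonoOn_of_deriv_pos (convex_Iic 1) hτc.continuousOn fun y hy => ?_
      rw [interior_Iic] at hy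
      rw [(hτd y hy).deriv]
      exact hpos y hy
    · intro a ha b hb hab
      have h1 : max (a - 1) 0 = a - 1 := max_eq_left (by linarith [Set.mem_Ici.1 ha])
      have h2 : max (b - 1) 0 = b - 1 := max_eq_left (by linarith [Set.mem_Ici.1 hb])
      simp only [τ, h1, h2]
      linarith [hImono hab.le]
  have hI0 : I 0 = 0 := by simp [I]
  have hsurj : Function.Surjective τ := by
    refine hτc.surjective ?_ ?_
    · refine tendsto_atTop_mono' atTop (f₁ := fun y => y - 1) ?_
        (tendsto_atTop_add_const_right atTop (-1) tendsto_id)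
      filter_upwards [eventually_ge_atTop 0] with y hy
      have := hImono hy
      rw [hI0] at this
      have h2 := le_max_left (y - 1) 0
      simp only [τ]; linarith
    · refine Tendsto.congr' (f₁ := fun y => y) ?_ tendsto_id
      filter_upwards [eventually_le_atBot 0] with y hy
      have h1 : max (y - 1) 0 = 0 := max_eq_right (by linarith)
      have h2 : I y = y := by
        have : ∫ q in (0 : ℝ)..y, H q = ∫ q in (0 : ℝ)..y, (1 : ℝ) := by
          refine intervalIntegral.integral_congr fun q hq => hone q ?_
          rw [Set.uIcc_of_ge hy] at hq
          exact hq.2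
        simp [I, this]
      simp [τ, h1, h2]
  let e := hmono.orderIsoOfSurjective τ hsurj
  have he : ∀ φ, e φ = τ φ := fun _ => rfl
  have hτ0 : τ 0 = 0 := by simp [τ, hI0]
  have hψ : ∀ r, τ (e.symm r) = r := fun r => e.apply_symm_apply r
  have hψ1 : e.symm (τ 1) = 1 := e.symm_apply_apply 1
  refine ⟨e.symm, τ 1, ?_, ?_, e.symm.continuous, e.symm.strictMono, ?_, hψ1, ?_⟩
  · rw [← hτ0]; exact hmono zero_lt_one
  · have : I 1 ≤ ∫ q in (0 : ℝ)..1, (1 : ℝ) :=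
      intervalIntegral.integral_mono zero_le_one (hc.intervalIntegrable _ _) (by simp) hH1
    simpa [τ] using this
  · have := e.symm_apply_apply 0
    rwa [he, hτ0] at this
  · intro r hr
    have h1 : e.symm r < 1 := by rw [← hψ1]; exact e.symm.strictMono hr
    exact HasDerivAt.of_local_left_inverse e.symm.continuous.continuousAt (hτd _ h1)
      (hpos _ h1).ne' (Eventually.of_forall hψ)

end

section

variable {D : ℕ} {p : Fin (D + 1) → ℝ}

lemma halfEdgeMass_eq_zero_iff {e : Fin (D + 1) → ℝ} (he : ∀ j, 0 ≤ e j) :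
    halfEdgeMass e = 0 ↔ ∀ j ≠ 0, e j = 0 := by
  rw [halfEdgeMass, Finset.sum_eq_zero_iff_of_nonneg
    fun k _ => mul_nonneg (Nat.cast_nonneg _) (he k)]
  refine ⟨fun h j hj => ?_, fun h j _ => ?_⟩
  · have := h j (Finset.mem_univ _)
    rcases mul_eq_zero.1 this with h1 | h1
    · exact absurd (Fin.ext (by simpa using h1)) hj
    · exact h1
  · by_cases hj : j = 0
    · simp [hj]
    · simp [h j hj]

/-- The explicit path: with the survival function `θ` and the time change `ψ`, it is
`u = λ θ²`, `eᵢ = pᵢ (1 - φ) θⁱ` at `φ = ψ r`. -/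
theorem exists_fluidPath (hp : ∀ j, 0 ≤ p j) (hp_sum : ∑ j, p j = 1) :
    ∃ (x : ℝ → State D) (t : Fin (D + 1) → ℝ) (T : ℝ),
      IsFluidPath p x t T ∧ 0 < T ∧ IsGreatest (Set.range t) T ∧
      (0 < halfEdgeMass p →
        IsGreatest (t '' {i | i ≠ 0}) T ∧ ∀ r ∈ Set.Ico 0 T, 0 < (x r).2.1) ∧
      (∀ r ∈ Set.Icc (0 : ℝ) 1, x r ∈ stateSpace D (halfEdgeMass p)) := by
  obtain ⟨θ, hθc, hθ0, hθd, hθb⟩ := exists_survival hp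
  let c : ℝ → ℝ := fun z => max 0 (min 1 z)
  have hc : ∀ z, c z ∈ Set.Icc (0 : ℝ) 1 := fun z =>
    ⟨le_max_left _ _, max_le zero_le_one (min_le_left _ _)⟩
  have hcc : Continuous c := by fun_prop
  have hθnn : ∀ z, 0 ≤ θ (c z) := fun z => by linarith [(hθb _ (hc z)).1, (hc z).2]
  obtain ⟨ψ, T, hT0, hT1, hψc, hψm, hψ0, hψT, hψd⟩ :=
    exists_timeChange (H := fun φ => genFun p (θ (c φ)))
      (continuous_genFun.comp (hθc.comp hcc))
      (fun φ hφ => by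
        refine genFun_pos hp hp_sum ?_
        have h1 := (hθb _ (hc φ)).1
        have : c φ < 1 := max_lt zero_lt_one (min_lt_of_right_lt hφ)
        linarith)
      (fun φ _ => genFun_nonneg hp (hθnn φ))
      (fun φ hφ => by
        have : c φ = 0 := max_eq_left (min_le_of_right_le hφ)
        simp [this, hθ0, genFun_one hp_sum])
      (fun φ => genFun_le_one hp hp_sum (hθnn φ) (hθb _ (hc φ)).2)
  let φ : ℝ → ℝ := fun r => c (ψ r)
  have hφc : Continuous φ := hcc.comp hψc
  have hφeq : ∀ r ∈ Set.Icc 0 T, φ r = ψ r := by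
    intro r hr
    have h0 : 0 ≤ ψ r := by rw [← hψ0]; exact hψm.monotone hr.1
    have h1 : ψ r ≤ 1 := by rw [← hψT]; exact hψm.monotone hr.2
    simp [φ, c, h0, h1]
  have hφlt : ∀ r ∈ Set.Ico 0 T, φ r < 1 := by
    intro r hr
    rw [hφeq r ⟨hr.1, hr.2.le⟩, ← hψT]
    exact hψm hr.2
  have hφ0 : φ 0 = 0 := by rw [hφeq 0 ⟨le_rfl, hT0.le⟩, hψ0]
  have hφT : ∀ r, T ≤ r → φ r = 1 := by
    intro r hr
    have h1 : 1 ≤ ψ r := by rw [← hψT]; exact hψm.monotone hr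
    simp [φ, c, h1]
  have hφm : ∀ r, φ r ∈ Set.Icc (0 : ℝ) 1 := fun r => hc _
  have hθφ : ∀ r, 1 - φ r ≤ θ (φ r) ∧ θ (φ r) ≤ 1 := fun r => hθb _ (hφm r)
  have hθφ0 : ∀ r, 0 ≤ θ (φ r) := fun r => hθnn _
  have hθpos : ∀ r ∈ Set.Ico 0 T, 0 < θ (φ r) := fun r hr => by
    linarith [(hθφ r).1, hφlt r hr]
  have hgpos : ∀ r ∈ Set.Ico 0 T, 0 < genFun p (θ (φ r)) := fun r hr =>
    genFun_pos hp hp_sum (hθpos r hr)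
  -- at `r = 0` only the derivative within `[0, 1]` is available, since `φ` is clamped
  have hφd : ∀ r ∈ Set.Ico 0 T,
      HasDerivWithinAt φ (genFun p (θ (φ r)))⁻¹ (Set.Icc 0 1) r := by
    intro r hr
    have hr' : r ∈ Set.Icc 0 T := ⟨hr.1, hr.2.le⟩
    have h1 := (hψd r hr.2).hasDerivWithinAt (s := Set.Icc 0 1)
    refine h1.congr_of_eventuallyEq ?_ (hφeq r hr')
    filter_upwards [self_mem_nhdsWithin, mem_nhdsWithin_of_mem_nhds (Iio_mem_nhds hr.2)]
      with y hy hy'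
    exact hφeq y ⟨hy.1, (Set.mem_Iio.1 hy').le⟩
  have hθφd : ∀ r ∈ Set.Ico 0 T, HasDerivWithinAt (fun r => θ (φ r))
      (-sizeBiasFun p (θ (φ r)) * (genFun p (θ (φ r)))⁻¹) (Set.Icc 0 1) r := by
    intro r hr
    exact (hθd (φ r) ⟨(hφm r).1, hφlt r hr⟩).comp_hasDerivWithinAt r (hφd r hr)
  let E : ℝ → Fin (D + 1) → ℝ := fun r i => p i * (1 - φ r) * θ (φ r) ^ (i : ℕ)
  have hEnn : ∀ r i, 0 ≤ E r i := fun r i =>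
    mul_nonneg (mul_nonneg (hp i) (sub_nonneg.2 (hφm r).2)) (pow_nonneg (hθφ0 r) _)
  have hEsum : ∀ r, ∑ k, E r k = (1 - φ r) * genFun p (θ (φ r)) := by
    intro r
    rw [genFun, Finset.mul_sum]
    exact Finset.sum_congr rfl fun k _ => by simp only [E]; ring
  have hM : ∀ r, halfEdgeMass (E r)
      = (1 - φ r) * θ (φ r) * (halfEdgeMass p * sizeBiasFun p (θ (φ r))) :=
    fun r => halfEdgeMass_explicit hp _ _
  have hET : ∀ r, T ≤ r → ∀ i, E r i = 0 := fun r hr i => by simp [E, hφT r hr]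
  have hEpos : ∀ r ∈ Set.Ico 0 T, ∀ i, 0 < p i → 0 < E r i := fun r hr i hi =>
    mul_pos (mul_pos hi (sub_pos.2 (hφlt r hr))) (pow_pos (hθpos r hr) _)
  have hEzero : ∀ r i, p i = 0 → E r i = 0 := fun r i hi => by simp [E, hi]
  let x : ℝ → State D := fun r => (min r T, halfEdgeMass p * θ (φ r) ^ 2, E r)
  have hxE : ∀ r, (x r).2.2 = E r := fun _ => rfl
  let t : Fin (D + 1) → ℝ := fun i => if p i = 0 then 0 else T
  have htpos : ∀ i, 0 < p i → t i = T := fun i hi => if_neg hi.ne'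
  have htT : ∀ i, t i ≤ T := fun i => by
    simp only [t]; split_ifs
    exacts [hT0.le, le_rfl]
  have hEt : ∀ i r, t i ≤ r → E r i = 0 := by
    intro i r hr
    by_cases hi : p i = 0
    · exact hEzero r i hi
    · refine hET r ?_ i
      rwa [htpos i (lt_of_le_of_ne (hp i) (Ne.symm hi))] at hr
  refine ⟨x, t, T, ?_, hT0, ?_, ?_, ?_⟩
  · refine ⟨?_, ?_, ?_, ?_, ?_, ?_, ?_, fun i r hr => hEt i r hr.1, ?_⟩
    · simp only [x, E, hφ0, hθ0]
      simp [hT0.le]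
    · refine Continuous.continuousOn ?_
      have : Continuous fun r => θ (φ r) := hθc.comp hφc
      simp only [x, E]
      fun_prop
    · intro i
      refine ⟨⟨⟨?_, (htT i).trans hT1⟩, (hEt i _ le_rfl).le⟩, fun r hr => ?_⟩
      · simp only [t]; split_ifs
        exacts [le_rfl, hT0.le]
      · by_cases hi : p i = 0
        · simpa [t, hi] using hr.1.1
        · have hi' := lt_of_le_of_ne (hp i) (Ne.symm hi)
          rw [htpos i hi']
          by_contra! h
          exact absurd hr.2 (not_le.2 (hEpos r ⟨hr.1.1, h⟩ i hi'))
    · refine ⟨⟨⟨hT0.le, hT1⟩, Finset.sum_eq_zero fun k _ => hET T le_rfl k⟩, fun r hr => ?_⟩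
      by_contra! h
      have h1 : ∑ k, E r k = 0 := hr.2
      rw [hEsum] at h1
      exact (mul_pos (sub_pos.2 (hφlt r ⟨hr.1.1, h⟩)) (hgpos r ⟨hr.1.1, h⟩)).ne' h1
    · intro r hr
      refine (hasDerivWithinAt_id r _).congr_of_eventuallyEq ?_ (min_eq_left hr.2.le)
      filter_upwards [mem_nhdsWithin_of_mem_nhds (Iio_mem_nhds hr.2)] with y hy
      exact min_eq_left (Set.mem_Iio.1 hy).le
    · intro r hr
      have := ((hθφd r hr).pow 2).const_mul (halfEdgeMass p)
      refine this.congr_deriv ?_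
      rw [hxE, uRate, hEsum, hM]
      have h1 := (hgpos r hr).ne'
      have h2 : 1 - φ r ≠ 0 := (sub_pos.2 (hφlt r hr)).ne'
      field_simp
      ring
    · intro i r hr
      have hpi : p i ≠ 0 := by
        intro h
        have : t i = 0 := if_pos h
        rw [this] at hr
        exact absurd hr.1 (not_le.2 hr.2)
      rw [htpos i (lt_of_le_of_ne (hp i) (Ne.symm hpi))] at hr
      have := (((hφd r hr).const_sub 1).const_mul (p i)).mul ((hθφd r hr).pow (i : ℕ))
      refine this.congr_deriv ?_
      rw [hxE, eRate, hEsum, hM]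
      have h1 := (hgpos r hr).ne'
      have h2 : 1 - φ r ≠ 0 := (sub_pos.2 (hφlt r hr)).ne'
      have h3 := (hθpos r hr).ne'
      simp only [x, E]
      by_cases hl : halfEdgeMass p = 0
      · have : (i : ℕ) = 0 := by
          by_contra hi
          exact hpi ((halfEdgeMass_eq_zero_iff hp).1 hl i fun h => hi (by simp [h]))
        simp only [this, hl]
        field_simp
        simp
      · rcases Nat.eq_zero_or_pos (i : ℕ) with h | h
        · simp only [h]
          field_simp
          simp
        · obtain ⟨m, hm⟩ := Nat.exists_eq_succ_of_ne_zero h.ne'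
          simp only [hm, Nat.succ_sub_one, pow_succ, Pi.pow_apply, Nat.succ_eq_add_one]
          field_simp
          ring
    · intro r hr
      simp only [x, E, hφT r hr.1, hφT T le_rfl, min_eq_right hr.1, min_self]
  · obtain ⟨j, -, hj⟩ : ∃ j ∈ Finset.univ, p j ≠ 0 := by
      apply Finset.exists_ne_zero_of_sum_ne_zero; rw [hp_sum]; norm_num
    refine ⟨⟨j, if_neg hj⟩, ?_⟩
    rintro _ ⟨i, rfl⟩
    exact htT i
  · intro hl
    refine ⟨⟨?_, ?_⟩, fun r hr => mul_pos hl (pow_pos (hθpos r hr) 2)⟩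
    · have : ¬ ∀ j ≠ 0, p j = 0 := fun h => hl.ne' ((halfEdgeMass_eq_zero_iff hp).2 h)
      push Not at this
      obtain ⟨j, hj, hpj⟩ := this
      exact ⟨j, hj, if_neg hpj⟩
    · rintro _ ⟨i, -, rfl⟩
      exact htT i
  · intro r hr
    have hl := halfEdgeMass_nonneg hp
    have hE1 : ∀ i, E r i ≤ 1 := fun i => by
      have h1 : p i ≤ 1 := by
        rw [← hp_sum]; exact Finset.single_le_sum (fun k _ => hp k) (Finset.mem_univ i)
      have h2 : θ (φ r) ^ (i : ℕ) ≤ 1 := pow_le_one₀ (hθφ0 r) (hθφ r).2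
      have h3 : p i * (1 - φ r) ≤ 1 :=
        mul_le_one₀ h1 (sub_nonneg.2 (hφm r).2) (by linarith [(hφm r).1])
      exact mul_le_one₀ h3 (pow_nonneg (hθφ0 r) _) h2
    refine ⟨⟨le_min hr.1 hT0.le, (min_le_left _ _).trans hr.2⟩, fun i => ⟨hEnn r i, hE1 i⟩, ?_, ?_⟩
    · rw [hxE, hM]
      have h1 := sizeBiasFun_le_one hp (hθφ0 r) (hθφ r).2
      have h2 := sizeBiasFun_nonneg hp (hθφ0 r)
      calc (1 - φ r) * θ (φ r) * (halfEdgeMass p * sizeBiasFun p (θ (φ r)))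
          ≤ θ (φ r) * θ (φ r) * (halfEdgeMass p * 1) := by
            have := (hθφ r).1
            have := hθφ0 r
            gcongr
        _ = halfEdgeMass p * θ (φ r) ^ 2 := by ring
    · exact mul_le_of_le_one_right hl (pow_le_one₀ (hθφ0 r) (hθφ r).2)

end

/-! ### The vector field and uniqueness -/

/-- The right-hand side of the fluid equation. -/
noncomputable def drift (D : ℕ) (z : State D) : State D :=
  (1, uRate z.2.2, eRate z.2.1 z.2.2)

/-- The open set of states on which the fluid equation is regular. -/
def regular (D : ℕ) : Set (State D) := {z | 0 < z.2.1 ∧ 0 < ∑ k, z.2.2 k}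

lemma isOpen_regular (D : ℕ) : IsOpen (regular D) := by
  have h1 : Continuous fun z : State D => z.2.1 := by fun_prop
  have h2 : Continuous fun z : State D => ∑ k, z.2.2 k := by fun_prop
  exact (isOpen_lt continuous_const h1).inter (isOpen_lt continuous_const h2)

lemma contDiffAt_drift {D : ℕ} {z : State D} (hz : z ∈ regular D) : ContDiffAt ℝ 1 (drift D) z := by
  have h1 : z.2.1 ≠ 0 := hz.1.ne'
  have h2 : ∑ k, z.2.2 k ≠ 0 := hz.2.ne'
  have hE : ∀ i, ContDiffAt ℝ 1 (fun z : State D => z.2.2 i) z := fun i =>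
    (contDiff_apply ℝ ℝ i |>.comp (contDiff_snd.comp contDiff_snd)).contDiffAt
  have hu : ContDiffAt ℝ 1 (fun z : State D => z.2.1) z :=
    (contDiff_fst.comp contDiff_snd).contDiffAt
  have hM : ContDiffAt ℝ 1 (fun z : State D => halfEdgeMass z.2.2) z :=
    ContDiffAt.sum fun k _ => contDiffAt_const.mul (hE k)
  have hS : ContDiffAt ℝ 1 (fun z : State D => ∑ k, z.2.2 k) z :=
    ContDiffAt.sum fun k _ => hE k
  refine contDiffAt_const.prodMk (ContDiffAt.prodMk ?_ ?_)
  · exact (contDiffAt_const.mul hM).div hS h2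
  · refine contDiffAt_pi.2 fun i => ?_
    exact ((hE i).neg.sub (((contDiffAt_const.mul (hE i)).div hu h1).mul hM)).div hS h2

lemma locallyLipschitzOn_drift {D : ℕ} {C : Set (State D)} (hC : C ⊆ regular D) :
    LocallyLipschitzOn C (drift D) := by
  intro z hz
  obtain ⟨K, s, hs, hK⟩ := (contDiffAt_drift (hC hz)).exists_lipschitzOnWith
  exact ⟨K, s, mem_nhdsWithin_of_mem_nhds hs, hK⟩

namespace IsFluidPath

variable {D : ℕ} {p : Fin (D + 1) → ℝ} {x y : ℝ → State D} {t t' : Fin (D + 1) → ℝ} {T T' : ℝ}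

lemma T_mem (h : IsFluidPath p x t T) : T ∈ Set.Icc (0 : ℝ) 1 := h.terminal.1.1

lemma sum_T (h : IsFluidPath p x t T) : ∑ k, (x T).2.2 k = 0 := h.terminal.1.2

lemma e_nonneg (h : IsFluidPath p x t T) {r : ℝ} (hr : r ∈ Set.Icc (0 : ℝ) 1)
    (i : Fin (D + 1)) : 0 ≤ (x r).2.2 i := by
  rcases lt_or_ge r (t i) with hi | hi
  · by_contra! hlt
    exact absurd ((h.extinction i).2 ⟨hr, hlt.le⟩) (not_le.2 hi)
  · exact (h.e_frozen i r ⟨hi, hr.2⟩).ge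

lemma sum_pos (h : IsFluidPath p x t T) {r : ℝ} (hr : r ∈ Set.Ico 0 T) :
    0 < ∑ k, (x r).2.2 k := by
  have hr' : r ∈ Set.Icc (0 : ℝ) 1 := ⟨hr.1, hr.2.le.trans h.T_mem.2⟩
  refine lt_of_le_of_ne (Finset.sum_nonneg fun k _ => h.e_nonneg hr' k) fun h0 => ?_
  exact absurd (h.terminal.2 ⟨hr', h0.symm⟩) (not_le.2 hr.2)

lemma e_T (h : IsFluidPath p x t T) (i : Fin (D + 1)) : (x T).2.2 i = 0 :=
  (Finset.sum_eq_zero_iff_of_nonneg fun k _ => h.e_nonneg h.T_mem k).1 h.sum_T i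
    (Finset.mem_univ _)

/-- Beyond its extinction time a component is `0`, and so is its rate: before `T` the path solves
the fluid equation with right derivatives. -/
lemma hasDerivWithinAt_Ici (h : IsFluidPath p x t T) {r : ℝ} (hr : r ∈ Set.Ico 0 T) :
    HasDerivWithinAt x (drift D (x r)) (Set.Ici r) r := by
  have hr1 : r < 1 := hr.2.trans_le h.T_mem.2
  have hmem : Set.Icc (0 : ℝ) 1 ∈ 𝓝[Set.Ici r] r :=
    mem_of_superset (Icc_mem_nhdsGE hr1) (Set.Icc_subset_Icc_left hr.1)
  have he : ∀ i, HasDerivWithinAt (fun q => (x q).2.2 i) (eRate (x r).2.1 (x r).2.2 i)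
      (Set.Ici r) r := by
    intro i
    rcases lt_or_ge r (t i) with hi | hi
    · exact (h.e_ode i r ⟨hr.1, hi⟩).mono_of_mem_nhdsWithin hmem
    · have h0 := h.e_frozen i r ⟨hi, hr1.le⟩
      have : eRate (x r).2.1 (x r).2.2 i = 0 := by simp [eRate, h0]
      rw [this]
      refine (hasDerivWithinAt_const r _ (0 : ℝ)).congr_of_eventuallyEq ?_ h0
      filter_upwards [Icc_mem_nhdsGE hr1] with q hq
      exact h.e_frozen i q ⟨hi.trans hq.1, hq.2⟩
  have hs := (h.s_ode r hr).mono_of_mem_nhdsWithin hmem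
  have hu := (h.u_ode r hr).mono_of_mem_nhdsWithin hmem
  exact hs.prodMk (hu.prodMk (hasDerivWithinAt_pi.2 he))

/-- For vanishing mean degree the path is explicit. -/
lemma eq_of_halfEdgeMass_eq_zero (h : IsFluidPath p x t T) (hp : ∀ j, 0 ≤ p j)
    (hp_sum : ∑ j, p j = 1) (hl : halfEdgeMass p = 0) {r : ℝ} (hr : r ∈ Set.Icc (0 : ℝ) 1) :
    x r = (r, 0, fun i => if i = 0 then 1 - r else 0) := by
  have hp0 : ∀ j ≠ 0, p j = 0 := (halfEdgeMass_eq_zero_iff hp).1 hl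
  have he : ∀ r ∈ Set.Icc (0 : ℝ) 1, ∀ i ≠ 0, (x r).2.2 i = 0 := by
    intro r hr i hi
    have h0 : t i = 0 := by
      refine le_antisymm ((h.extinction i).2 ⟨by norm_num, ?_⟩) (h.extinction i).1.1.1
      rw [h.init]
      exact (hp0 i hi).le
    exact h.e_frozen i r (by rw [h0]; exact hr)
  have hM : ∀ r ∈ Set.Icc (0 : ℝ) 1, halfEdgeMass (x r).2.2 = 0 := fun r hr =>
    (halfEdgeMass_eq_zero_iff fun j => h.e_nonneg hr j).2 (he r hr)
  have hsum : ∀ r ∈ Set.Icc (0 : ℝ) 1, ∑ k, (x r).2.2 k = (x r).2.2 0 := fun r hr =>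
    Finset.sum_eq_single 0 (fun i _ hi => he r hr i hi) (by simp)
  have hp1 : p 0 = 1 := by
    rw [← hp_sum]
    exact (Finset.sum_eq_single 0 (fun i _ hi => hp0 i hi) (by simp)).symm
  let z : ℝ → State D := fun r => (r, 0, fun i => if i = 0 then 1 - r else 0)
  have hzd : ∀ r, HasDerivAt z (1, 0, fun i => if i = 0 then -1 else 0) r := by
    intro r
    refine (hasDerivAt_id r).prodMk ((hasDerivAt_const r _).prodMk (hasDerivAt_pi.2 fun i => ?_))
    by_cases hi : i = 0
    · simpa [hi] using (hasDerivAt_id r).const_sub 1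
    · simpa [hi] using hasDerivAt_const r (0 : ℝ)
  have hxd : ∀ r ∈ Set.Ico 0 T,
      HasDerivWithinAt x (1, 0, fun i => if i = 0 then -1 else 0) (Set.Ici r) r := by
    intro r hr
    have hr' : r ∈ Set.Icc (0 : ℝ) 1 := ⟨hr.1, hr.2.le.trans h.T_mem.2⟩
    refine (h.hasDerivWithinAt_Ici hr).congr_deriv ?_
    have hpos := h.sum_pos hr
    have h0 : (x r).2.2 0 ≠ 0 := by rw [← hsum r hr']; exact hpos.ne'
    refine Prod.ext rfl (Prod.ext ?_ (funext fun i => ?_))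
    · simp [drift, uRate, hM r hr']
    · by_cases hi : i = 0
      · subst hi
        simp only [drift, eRate, hM r hr', hsum r hr']
        simp
        field_simp
      · simp [drift, eRate, he r hr' i hi, hi]
  have heq : Set.EqOn x z (Set.Icc 0 T) := by
    refine eq_of_has_deriv_right_eq (f' := fun _ => (1, 0, fun i => if i = 0 then -1 else 0)) hxd
      (fun r _ => (hzd r).hasDerivWithinAt) (h.cont.mono (Set.Icc_subset_Icc_right h.T_mem.2))
      (fun r _ => (hzd r).continuousAt.continuousWithinAt) ?_
    simp only [h.init, z, hl]
    refine Prod.ext rfl (Prod.ext rfl (funext fun i => ?_))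
    by_cases hi : i = 0
    · simp [hi, hp1]
    · simp [hi, hp0 i hi]
  have hT : T = 1 := by
    have h1 := h.e_T 0
    rw [heq ⟨h.T_mem.1, le_rfl⟩] at h1
    simp only [z, if_true] at h1
    linarith
  rw [hT] at heq
  exact heq hr

/-- Two fluid paths coincide as long as neither is stopped, if the first stays in the regular set:
by continuity so does the second, for a short while after any time up to which they agree. -/
lemma eqOn_Icc_min (hx : IsFluidPath p x t T) (hy : IsFluidPath p y t' T')
    (hreg : ∀ r ∈ Set.Ico 0 T, x r ∈ regular D) : Set.EqOn x y (Set.Icc 0 (min T T')) := by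
  have hm1 : min T T' ≤ 1 := (min_le_left _ _).trans hx.T_mem.2
  have hsub : Set.Icc 0 (min T T') ⊆ Set.Icc 0 1 := Set.Icc_subset_Icc_right hm1
  have hxc := hx.cont.mono hsub
  have hyc := hy.cont.mono hsub
  refine IsClosed.Icc_subset_of_forall_mem_nhdsWithin (s := {r | x r = y r}) ?_ ?_ ?_
  · have : {r | x r = y r} ∩ Set.Icc 0 (min T T')
        = Set.Icc 0 (min T T') ∩ (fun r => (x r, y r)) ⁻¹' {z | z.1 = z.2} := by
      ext r; simp [and_comm]
    rw [this]
    exact (hxc.prodMk hyc).preimage_isClosed_of_isClosed isClosed_Icc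
      (isClosed_eq continuous_fst continuous_snd)
  · simp [hx.init, hy.init]
  · rintro r ⟨hr, hr0, hrm⟩
    have hrT : r ∈ Set.Ico 0 T := ⟨hr0, hrm.trans_le (min_le_left _ _)⟩
    obtain ⟨K, s, hs, hK⟩ := (contDiffAt_drift (hreg r hrT)).exists_lipschitzOnWith
    have hnear : ∀ f : ℝ → State D, ContinuousOn f (Set.Icc 0 (min T T')) → f r = x r →
        ∀ᶠ q in 𝓝[≥] r, f q ∈ s := by
      intro f hf hfr
      have h1 : ContinuousWithinAt f (Set.Ici r) r :=
        (hf r ⟨hr0, hrm.le⟩).mono_of_mem_nhdsWithin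
          (mem_of_superset (Icc_mem_nhdsGE hrm) (Set.Icc_subset_Icc_left hr0))
      exact h1 (by rw [hfr]; exact hs)
    have hall := (hnear x hxc rfl).and ((hnear y hyc hr.symm).and (Icc_mem_nhdsGE hrm))
    obtain ⟨b, hb, hbs⟩ := (mem_nhdsGE_iff_exists_Icc_subset).1 hall
    have hb1 : b ∈ Set.Icc r (min T T') := (hbs ⟨(Set.mem_Ioi.1 hb).le, le_rfl⟩).2.2
    have hsub' : Set.Icc r b ⊆ Set.Icc 0 (min T T') := Set.Icc_subset_Icc hr0 hb1.2
    have := ODE_solution_unique_of_mem_Icc_right (v := fun _ => drift D) (s := fun _ => s)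
      (f := x) (g := y) (a := r) (b := b) (K := K) (fun _ _ => hK) (hxc.mono hsub')
      (fun q hq => hx.hasDerivWithinAt_Ici
        ⟨hr0.trans hq.1, hq.2.trans_le (hb1.2.trans (min_le_left _ _))⟩)
      (fun q hq => (hbs ⟨hq.1, hq.2.le⟩).1) (hyc.mono hsub')
      (fun q hq => hy.hasDerivWithinAt_Ici
        ⟨hr0.trans hq.1, hq.2.trans_le (hb1.2.trans (min_le_right _ _))⟩)
      (fun q hq => (hbs ⟨hq.1, hq.2.le⟩).2.1) hr
    filter_upwards [Ioc_mem_nhdsGT (Set.mem_Ioi.1 hb)] with q hq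
    exact this ⟨hq.1.le, hq.2⟩

lemma eqOn_of_regular (hx : IsFluidPath p x t T) (hy : IsFluidPath p y t' T')
    (hreg : ∀ r ∈ Set.Ico 0 T, x r ∈ regular D) : Set.EqOn y x (Set.Icc 0 1) := by
  have h := hx.eqOn_Icc_min hy hreg
  have hTT : T = T' := by
    rcases lt_trichotomy T T' with h1 | h1 | h1
    · rw [min_eq_left h1.le] at h
      have h2 := hy.sum_pos ⟨hx.T_mem.1, h1⟩
      rw [← h ⟨hx.T_mem.1, le_rfl⟩, hx.sum_T] at h2
      exact absurd h2 (lt_irrefl _)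
    · exact h1
    · rw [min_eq_right h1.le] at h
      have h2 := hx.sum_pos ⟨hy.T_mem.1, h1⟩
      rw [h ⟨hy.T_mem.1, le_rfl⟩, hy.sum_T] at h2
      exact absurd h2 (lt_irrefl _)
  subst hTT
  rw [min_self] at h
  intro r hr
  rcases le_total r T with h1 | h1
  · exact (h ⟨hr.1, h1⟩).symm
  · rw [hx.stopped r ⟨h1, hr.2⟩, hy.stopped r ⟨h1, hr.2⟩]
    exact (h ⟨hx.T_mem.1, le_rfl⟩).symm

theorem unique (hx : IsFluidPath p x t T) (hy : IsFluidPath p y t' T') (hp : ∀ j, 0 ≤ p j)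
    (hp_sum : ∑ j, p j = 1)
    (hu : 0 < halfEdgeMass p → ∀ r ∈ Set.Ico 0 T, 0 < (x r).2.1) :
    Set.EqOn y x (Set.Icc 0 1) ∧ t' = t ∧ T' = T := by
  have heq : Set.EqOn y x (Set.Icc 0 1) := by
    rcases (halfEdgeMass_nonneg hp).eq_or_lt with hl | hl
    · intro r hr
      rw [hx.eq_of_halfEdgeMass_eq_zero hp hp_sum hl.symm hr,
        hy.eq_of_halfEdgeMass_eq_zero hp hp_sum hl.symm hr]
    · exact hx.eqOn_of_regular hy fun r hr => ⟨hu hl r hr, hx.sum_pos hr⟩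
  refine ⟨heq, funext fun i => ?_, ?_⟩
  · refine (hy.extinction i).unique ?_
    have : {r | r ∈ Set.Icc (0 : ℝ) 1 ∧ (y r).2.2 i ≤ 0}
        = {r | r ∈ Set.Icc (0 : ℝ) 1 ∧ (x r).2.2 i ≤ 0} :=
      Set.ext fun r => and_congr_right fun hr => by rw [heq hr]
    rw [this]
    exact hx.extinction i
  · refine hy.terminal.unique ?_
    have : {r | r ∈ Set.Icc (0 : ℝ) 1 ∧ ∑ k, (y r).2.2 k = 0}
        = {r | r ∈ Set.Icc (0 : ℝ) 1 ∧ ∑ k, (x r).2.2 k = 0} :=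
      Set.ext fun r => and_congr_right fun hr => by rw [heq hr]
    rw [this]
    exact hx.terminal

end IsFluidPath

/-! ### Expectations of finite probability mass functions -/

/-- The expectation of `f` under `q`. -/
noncomputable def expect {α : Type*} [Fintype α] (q : PMF α) (f : α → ℝ) : ℝ :=
  ∑ a, (q a).toReal * f a

section Expect

variable {α β : Type*} [Fintype α] [Fintype β]

lemma sum_toReal_eq_one (q : PMF α) : ∑ a, (q a).toReal = 1 := by
  have h := q.tsum_coe
  rw [tsum_fintype] at h
  rw [← ENNReal.toReal_sum fun a _ => q.apply_ne_top a, h, ENNReal.toReal_one]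

lemma expect_const (q : PMF α) (r : ℝ) : expect q (fun _ => r) = r := by
  rw [expect, ← Finset.sum_mul, sum_toReal_eq_one, one_mul]

lemma expect_sub (q : PMF α) (f g : α → ℝ) :
    expect q (fun a => f a - g a) = expect q f - expect q g := by
  simp only [expect, mul_sub, Finset.sum_sub_distrib]

lemma expect_mul_left (q : PMF α) (r : ℝ) (f : α → ℝ) :
    expect q (fun a => r * f a) = r * expect q f := by
  simp only [expect, Finset.mul_sum]
  exact Finset.sum_congr rfl fun a _ => by ring

lemma expect_neg (q : PMF α) (f : α → ℝ) : expect q (fun a => -f a) = -expect q f := by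
  simp [expect]

lemma expect_mono {q : PMF α} {f g : α → ℝ} (h : ∀ a ∈ q.support, f a ≤ g a) :
    expect q f ≤ expect q g := by
  refine Finset.sum_le_sum fun a _ => ?_
  by_cases ha : a ∈ q.support
  · exact mul_le_mul_of_nonneg_left (h a ha) ENNReal.toReal_nonneg
  · rw [PMF.mem_support_iff, not_not] at ha
    simp [ha]

lemma abs_expect_sub_le {q : PMF α} {f g : α → ℝ} {r : ℝ}
    (h : ∀ a ∈ q.support, |f a - g a| ≤ r) : |expect q f - expect q g| ≤ r := by
  rw [← expect_sub, abs_le]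
  constructor
  · rw [← expect_const q (-r)]
    exact expect_mono fun a ha => (abs_le.1 (h a ha)).1
  · conv_rhs => rw [← expect_const q r]
    exact expect_mono fun a ha => (abs_le.1 (h a ha)).2

lemma expect_pure (a : α) (f : α → ℝ) : expect (PMF.pure a) f = f a := by
  classical
  rw [expect, Finset.sum_eq_single a]
  · simp
  · intro b _ hb
    simp [PMF.pure_apply, hb]
  · simp

lemma expect_bind (q : PMF α) (F : α → PMF β) (f : β → ℝ) :
    expect (q.bind F) f = expect q fun a => expect (F a) f := by
  have h : ∀ b, (q.bind F b).toReal = ∑ a, (q a).toReal * (F a b).toReal := by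
    intro b
    rw [PMF.bind_apply, tsum_fintype, ENNReal.toReal_sum]
    · simp only [ENNReal.toReal_mul]
    · exact fun a _ => ENNReal.mul_ne_top (q.apply_ne_top a) ((F a).apply_ne_top b)
  simp only [expect, h, Finset.sum_mul, Finset.mul_sum]
  rw [Finset.sum_comm]
  exact Finset.sum_congr rfl fun a _ => Finset.sum_congr rfl fun b _ => by ring

lemma expect_map (q : PMF α) (F : α → β) (f : β → ℝ) :
    expect (q.map F) f = expect q fun a => f (F a) := by
  rw [← PMF.bind_pure_comp, expect_bind]
  simp only [Function.comp, expect_pure]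

lemma expect_uniformOfFinset (s : Finset α) (hs : s.Nonempty) (f : α → ℝ) :
    expect (PMF.uniformOfFinset s hs) f = (∑ a ∈ s, f a) / s.card := by
  classical
  rw [expect, Finset.sum_div, ← Finset.sum_subset (Finset.subset_univ s)]
  · refine Finset.sum_congr rfl fun a ha => ?_
    rw [PMF.uniformOfFinset_apply_of_mem _ ha, ENNReal.toReal_inv, ENNReal.toReal_natCast]
    ring
  · intro a _ ha
    rw [PMF.uniformOfFinset_apply_of_notMem _ ha]
    simp

end Expect

/-! ### Changes of a configuration in one step -/

namespace Config

variable {N : ℕ} {deg : Fin N → ℕ}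

noncomputable instance : Fintype (Config deg) :=
  Fintype.ofInjective (fun c : Config deg => (c.indep, c.empty, c.unpaired)) fun a b h => by
    simp only [Prod.mk.injEq] at h
    exact Config.ext h.1 h.2.1 h.2.2

/-- Every half-edge of an empty vertex is still unpaired. -/
def Intact (c : Config deg) : Prop := ∀ h : HalfEdge deg, h.1 ∈ c.empty → h ∈ c.unpaired

lemma intact_initial : (initial deg).Intact := fun _ _ => Finset.mem_univ _

lemma Intact.select {c : Config deg} (hc : c.Intact) (v : Fin N) : (c.select v).Intact :=
  fun h hh => hc h (Finset.mem_of_mem_erase hh)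

lemma Intact.pair {c : Config deg} (hc : c.Intact) {h : HalfEdge deg} (hh : h.1 ∉ c.empty)
    (g : HalfEdge deg) : (c.pair h g).Intact := by
  intro x hx
  obtain ⟨h1, h2⟩ := Finset.mem_erase.1 hx
  refine Finset.mem_erase.2 ⟨fun e => h1 (by rw [e]), Finset.mem_erase.2 ⟨fun e => ?_, hc x h2⟩⟩
  exact hh (e ▸ h2)

/-- The bounds on the change from `c` to `c'` under `k` successive pairings. -/
structure PairBound (k : ℕ) (c c' : Config deg) : Prop where
  indep : c'.indep = c.indep
  empty : c'.empty ⊆ c.empty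
  unpaired : c'.unpaired ⊆ c.unpaired
  card_unpaired : c.unpaired.card ≤ c'.unpaired.card + 2 * k
  card_empty : c.empty.card ≤ c'.empty.card + k
  card_add : c.empty.card + c'.unpaired.card ≤ c'.empty.card + c.unpaired.card

lemma PairBound.refl (c : Config deg) : PairBound 0 c c :=
  ⟨rfl, subset_rfl, subset_rfl, by omega, by omega, le_rfl⟩

lemma PairBound.trans {k m : ℕ} {a b c : Config deg} (h : PairBound k a b) (h' : PairBound m b c) :
    PairBound (k + m) a c := by
  obtain ⟨h1, h2, h3, h4, h5, h6⟩ := h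
  obtain ⟨g1, g2, g3, g4, g5, g6⟩ := h'
  exact ⟨g1.trans h1, g2.trans h2, g3.trans h3, by omega, by omega, by omega⟩

lemma PairBound.mono {k m : ℕ} {a b : Config deg} (h : PairBound k a b) (hkm : k ≤ m) :
    PairBound m a b := by
  obtain ⟨h1, h2, h3, h4, h5, h6⟩ := h
  exact ⟨h1, h2, h3, by omega, by omega, by omega⟩

lemma mem_support_pairOne {c c' : Config deg} {h : HalfEdge deg}
    (hc : c' ∈ (c.pairOne h).support) :
    c' = c ∨ h ∈ c.unpaired ∧ ∃ g ∈ c.unpaired.erase h, c' = c.pair h g := by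
  unfold pairOne at hc
  split_ifs at hc with H
  · rw [PMF.mem_support_map_iff] at hc
    obtain ⟨g, hg, rfl⟩ := hc
    rw [PMF.mem_support_uniformOfFinset_iff] at hg
    exact Or.inr ⟨H.1, g, hg, rfl⟩
  · rw [PMF.mem_support_pure_iff] at hc
    exact Or.inl hc

lemma pairBound_of_mem_support_pairOne {c c' : Config deg} {h : HalfEdge deg}
    (hc : c' ∈ (c.pairOne h).support) : PairBound 1 c c' := by
  rcases mem_support_pairOne hc with rfl | ⟨hh, g, hg, rfl⟩
  · exact (PairBound.refl _).mono zero_le_one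
  · have h1 : (c.pair h g).unpaired.card + 2 = c.unpaired.card := by
      have e1 := Finset.card_erase_add_one hg
      have e2 := Finset.card_erase_add_one hh
      simp only [pair]
      omega
    have h2 : c.empty.card ≤ (c.pair h g).empty.card + 1 := by
      have := Finset.pred_card_le_card_erase (s := c.empty) (a := g.1)
      simp only [pair]
      omega
    exact ⟨rfl, Finset.erase_subset _ _,
      (Finset.erase_subset _ _).trans (Finset.erase_subset _ _), by omega, h2, by omega⟩

lemma intact_of_mem_support_pairOne {c c' : Config deg} {h : HalfEdge deg} (hi : c.Intact)
    (hh : h.1 ∉ c.empty) (hc : c' ∈ (c.pairOne h).support) : c'.Intact := by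
  rcases mem_support_pairOne hc with rfl | ⟨-, g, -, rfl⟩
  exacts [hi, hi.pair hh g]

lemma pairBound_of_mem_support_pairList {l : List (HalfEdge deg)} {c c' : Config deg}
    (hc : c' ∈ (pairList l c).support) : PairBound l.length c c' := by
  induction l generalizing c with
  | nil =>
    rw [pairList, PMF.mem_support_pure_iff] at hc
    subst hc
    exact PairBound.refl _
  | cons h l ih =>
    rw [pairList, PMF.mem_support_bind_iff] at hc
    obtain ⟨b, hb, hc⟩ := hc
    exact ((pairBound_of_mem_support_pairOne hb).trans (ih hc)).mono (by simp [add_comm])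

lemma intact_of_mem_support_pairList {l : List (HalfEdge deg)} {c c' : Config deg} (hi : c.Intact)
    (hl : ∀ h ∈ l, h.1 ∉ c.empty) (hc : c' ∈ (pairList l c).support) : c'.Intact := by
  induction l generalizing c with
  | nil =>
    rw [pairList, PMF.mem_support_pure_iff] at hc
    rwa [hc]
  | cons h l ih =>
    rw [pairList, PMF.mem_support_bind_iff] at hc
    obtain ⟨b, hb, hc⟩ := hc
    refine ih (intact_of_mem_support_pairOne hi (hl h (by simp)) hb) (fun g hg => ?_) hc
    exact fun h' => hl g (by simp [hg]) ((pairBound_of_mem_support_pairOne hb).empty h')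

lemma mem_halfEdges {v : Fin N} {h : HalfEdge deg} : h ∈ halfEdges deg v ↔ h.1 = v := by
  obtain ⟨i, a⟩ := h
  simp only [halfEdges, List.mem_map, List.mem_finRange, true_and]
  constructor
  · rintro ⟨b, hb⟩
    exact (congrArg Sigma.fst hb).symm
  · rintro rfl
    exact ⟨a, rfl⟩

lemma nodup_halfEdges (v : Fin N) : (halfEdges deg v).Nodup :=
  (List.nodup_finRange _).map fun a b h => by simpa using h

lemma length_halfEdges (v : Fin N) : (halfEdges deg v).length = deg v := by simp [halfEdges]

lemma mem_support_step {c c' : Config deg} (hc : c' ∈ c.step.support) :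
    (c.empty = ∅ ∧ c' = c) ∨
      ∃ v ∈ c.empty, c' ∈ (pairList (halfEdges deg v) (c.select v)).support := by
  unfold step at hc
  split_ifs at hc with H
  · rw [PMF.mem_support_bind_iff] at hc
    obtain ⟨v, hv, hc⟩ := hc
    rw [PMF.mem_support_uniformOfFinset_iff] at hv
    exact Or.inr ⟨v, hv, hc⟩
  · rw [PMF.mem_support_pure_iff] at hc
    exact Or.inl ⟨Finset.not_nonempty_iff_eq_empty.1 H, hc⟩

/-- The properties of the configurations which the algorithm can reach. -/
structure Reachable (c : Config deg) : Prop where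
  intact : c.Intact
  disjoint : Disjoint c.indep c.empty

lemma reachable_initial : (initial deg).Reachable :=
  ⟨intact_initial, by simp [initial]⟩

lemma Reachable.of_mem_support_step {c c' : Config deg} (h : c.Reachable)
    (hc : c' ∈ c.step.support) : c'.Reachable := by
  rcases mem_support_step hc with ⟨-, rfl⟩ | ⟨v, hv, hc⟩
  · exact h
  · have hb := pairBound_of_mem_support_pairList hc
    refine ⟨intact_of_mem_support_pairList (h.intact.select v) (fun g hg => ?_) hc, ?_⟩
    · rw [mem_halfEdges.1 hg]
      exact Finset.notMem_erase _ _
    · rw [hb.indep]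
      refine Disjoint.mono_right hb.empty ?_
      exact Finset.disjoint_insert_left.2 ⟨Finset.notMem_erase _ _,
        h.disjoint.mono_right (Finset.erase_subset _ _)⟩

/-- The bounds on the change from `c` to `c'` in a step of the algorithm in which a vertex is
selected, when all degrees are at most `D`. -/
structure StepBound (D : ℕ) (c c' : Config deg) : Prop where
  empty : c'.empty ⊆ c.empty
  unpaired : c'.unpaired ⊆ c.unpaired
  card_unpaired : c.unpaired.card ≤ c'.unpaired.card + 2 * D
  card_empty : c.empty.card ≤ c'.empty.card + (D + 1)
  card_add : c.empty.card + c'.unpaired.card ≤ c'.empty.card + c.unpaired.card + 1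
  card_empty_lt : c'.empty.card + 1 ≤ c.empty.card

lemma stepBound_of_mem_support {D : ℕ} (hD : ∀ i, deg i ≤ D) {c c' : Config deg} {v : Fin N}
    (hv : v ∈ c.empty) (hc : c' ∈ (pairList (halfEdges deg v) (c.select v)).support) :
    StepBound D c c' ∧ c'.indep = insert v c.indep := by
  have hb := pairBound_of_mem_support_pairList hc
  rw [length_halfEdges] at hb
  obtain ⟨h1, h2, h3, h4, h5, h6⟩ := hb.mono (hD v)
  have e := Finset.card_erase_add_one hv
  have e' := Finset.card_le_card h2
  simp only [select] at *
  exact ⟨⟨h2.trans (Finset.erase_subset _ _), h3, h4, by omega, by omega,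
    by omega⟩, h1⟩

end Config

namespace Config

variable {N : ℕ} {deg : Fin N → ℕ}

/-! ### The expected change in one step -/

/-- The empty vertices of degree `j`. -/
def emptyOfDeg (c : Config deg) (j : ℕ) : Finset (Fin N) := c.empty.filter fun i => deg i = j

/-- The number of half-edges in `L` that are still unpaired. -/
def live (L : Finset (HalfEdge deg)) (c : Config deg) : ℝ := ((L ∩ c.unpaired).card : ℝ)

lemma expect_pairOne {c : Config deg} {h : HalfEdge deg} (hh : h ∈ c.unpaired)
    (hU : 2 ≤ c.unpaired.card) (f : Config deg → ℝ) :
    expect (c.pairOne h) f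
      = (∑ g ∈ c.unpaired.erase h, f (c.pair h g)) / ((c.unpaired.card : ℝ) - 1) := by
  have e := Finset.card_erase_add_one hh
  have hne : (c.unpaired.erase h).Nonempty := by
    rw [← Finset.card_pos]; omega
  rw [pairOne, dif_pos ⟨hh, hne⟩, expect_map, expect_uniformOfFinset]
  congr 1
  rw [← e]; push_cast; ring

/-- A half-edge outside `L` is paired with one in `L` with probability at most
`#L / (U - 1)`. -/
lemma abs_expect_live_sub_le {c : Config deg} {h : HalfEdge deg} (hh : h ∈ c.unpaired)
    (hU : 2 ≤ c.unpaired.card) {L : Finset (HalfEdge deg)} (hL : h ∉ L) :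
    |expect (c.pairOne h) (live L) - live L c| ≤ L.card / ((c.unpaired.card : ℝ) - 1) := by
  have e := Finset.card_erase_add_one hh
  have e' : ((c.unpaired.erase h).card : ℝ) = (c.unpaired.card : ℝ) - 1 := by
    rw [← e]; push_cast; ring
  have hpos : (0 : ℝ) < (c.unpaired.card : ℝ) - 1 := by
    have : (2 : ℝ) ≤ c.unpaired.card := by exact_mod_cast hU
    linarith
  have hlive : ∀ g, live L (c.pair h g) = live L c - if g ∈ L ∩ c.unpaired then 1 else 0 := by
    intro g
    have h1 : L ∩ (c.pair h g).unpaired = (L ∩ c.unpaired).erase g := by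
      ext x
      simp only [pair, Finset.mem_inter, Finset.mem_erase]
      constructor
      · rintro ⟨a, b, -, d⟩; exact ⟨b, a, d⟩
      · rintro ⟨b, a, d⟩; exact ⟨a, b, fun hx => hL (hx ▸ a), d⟩
    rw [live, h1, live]
    split_ifs with hg
    · rw [← Finset.card_erase_add_one hg]; push_cast; ring
    · rw [Finset.erase_eq_of_notMem hg]; ring
  rw [expect_pairOne hh hU]
  simp only [hlive]
  rw [Finset.sum_sub_distrib, Finset.sum_const, nsmul_eq_mul, e', sub_div,
    mul_div_cancel_left₀ _ hpos.ne', sub_sub_cancel_left, abs_neg,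
    abs_of_nonneg (div_nonneg (Finset.sum_nonneg fun g _ => by split_ifs <;> norm_num) hpos.le)]
  gcongr
  rw [Finset.sum_boole]
  norm_cast
  refine Finset.card_le_card fun g hg => ?_
  exact (Finset.mem_inter.1 (Finset.mem_filter.1 hg).2).1

/-- If a single pairing of an unpaired half-edge of `v` changes `f` by `-ρ` on average, up to an
error `ε`, then pairing a list of such half-edges changes `f` by `-ρ` times the number of the
unpaired ones among them.  Half-edges of the list that are paired with each other only
contribute to the error. -/
lemma abs_expect_pairList_sub_le {f : Config deg → ℝ} {ρ ε m : ℝ} {K : ℕ} (hρ : |ρ| ≤ 2)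
    (hε : 0 ≤ ε) (hm : 0 < m) {v : Fin N} {b : Config deg}
    (hb : ∀ k ≤ K, ∀ c, PairBound k b c → 2 ≤ c.unpaired.card ∧ m ≤ (c.unpaired.card : ℝ) - 1)
    (hf : ∀ k ≤ K, ∀ c h, PairBound k b c → c.Intact → v ∉ c.empty → h.1 = v → h ∈ c.unpaired →
      |expect (c.pairOne h) f - f c + ρ| ≤ ε)
    (l : List (HalfEdge deg)) (hl : l.Nodup) (hlv : ∀ h ∈ l, h.1 = v) {k : ℕ}
    (hk : k + l.length ≤ K) {c : Config deg} (hbc : PairBound k b c) (hi : c.Intact)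
    (hv : v ∉ c.empty) :
    |expect (pairList l c) f - f c + ρ * live l.toFinset c| ≤ l.length * (ε + 2 * K / m) := by
  induction l generalizing k c with
  | nil => simp [pairList, expect_pure, live]
  | cons h l ih =>
    obtain ⟨hhl, hl'⟩ := List.nodup_cons.1 hl
    have hhv : h.1 = v := hlv h (by simp)
    have hlv' : ∀ g ∈ l, g.1 = v := fun g hg => hlv g (by simp [hg])
    simp only [List.length_cons] at hk
    have hη : 0 ≤ 2 * K / m := by positivity
    rw [pairList, expect_bind]
    by_cases hh : h ∈ c.unpaired
    · have h1 : |expect (c.pairOne h) (fun a => expect (pairList l a) f)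
          - expect (c.pairOne h) (fun a => f a - ρ * live l.toFinset a)|
          ≤ l.length * (ε + 2 * K / m) := by
        refine abs_expect_sub_le fun a ha => ?_
        have hab := pairBound_of_mem_support_pairOne ha
        have := ih hl' hlv' (k := k + 1) (by omega) (hbc.trans hab)
          (intact_of_mem_support_pairOne hi (by rwa [hhv]) ha) fun h' => hv (hab.empty h')
        rwa [← sub_add]
      rw [expect_sub, expect_mul_left] at h1
      have h2 := hf k (by omega) c h hbc hi hv hhv hh
      have h3 : |expect (c.pairOne h) (live l.toFinset) - live l.toFinset c| ≤ K / m := by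
        refine (abs_expect_live_sub_le hh (hb k (by omega) c hbc).1 (by simpa using hhl)).trans ?_
        have h4 := (hb k (by omega) c hbc).2
        have h5 : (l.toFinset.card : ℝ) ≤ K := by
          have := l.toFinset_card_le
          exact_mod_cast (by omega : l.toFinset.card ≤ K)
        gcongr
      have h4 : live (h :: l).toFinset c = live l.toFinset c + 1 := by
        have : (h :: l).toFinset ∩ c.unpaired = insert h (l.toFinset ∩ c.unpaired) := by
          rw [List.toFinset_cons, Finset.insert_inter_of_mem hh]
        rw [live, this, Finset.card_insert_of_notMem (by simp [hhl]), live]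
        push_cast; ring
      have h5 : |ρ * (expect (c.pairOne h) (live l.toFinset) - live l.toFinset c)|
          ≤ 2 * K / m := by
        rw [abs_mul, mul_div_assoc]
        exact mul_le_mul hρ h3 (abs_nonneg _) (by norm_num)
      rw [h4]
      simp only [List.length_cons, Nat.cast_add, Nat.cast_one, add_mul, one_mul, mul_add] at *
      rw [abs_le] at *
      constructor <;> nlinarith
    · have h1 : c.pairOne h = PMF.pure c := by
        rw [pairOne, dif_neg fun H => hh H.1]
      have h2 : (h :: l).toFinset ∩ c.unpaired = l.toFinset ∩ c.unpaired := by
        rw [List.toFinset_cons, Finset.insert_inter_of_notMem hh]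
      rw [h1, expect_pure, live, h2]
      refine (ih hl' hlv' (by omega) hbc hi hv).trans ?_
      simp only [List.length_cons, Nat.cast_add, Nat.cast_one]
      nlinarith

lemma expect_pairOne_unpaired {c : Config deg} {h : HalfEdge deg} (hh : h ∈ c.unpaired)
    (hU : 2 ≤ c.unpaired.card) :
    expect (c.pairOne h) (fun a => (a.unpaired.card : ℝ)) = c.unpaired.card - 2 := by
  have hpos : (0 : ℝ) < (c.unpaired.card : ℝ) - 1 := by
    have : (2 : ℝ) ≤ c.unpaired.card := by exact_mod_cast hU
    linarith
  have e2 := Finset.card_erase_add_one hh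
  rw [expect_pairOne hh hU, Finset.sum_congr rfl (g := fun _ => (c.unpaired.card : ℝ) - 2)]
  · have e' : ((c.unpaired.erase h).card : ℝ) = (c.unpaired.card : ℝ) - 1 := by
      rw [← e2]; push_cast; ring
    rw [Finset.sum_const, nsmul_eq_mul, e', mul_div_cancel_left₀ _ hpos.ne']
  · intro g hg
    have e1 := Finset.card_erase_add_one hg
    simp only [pair]
    rw [← e2, ← e1]; push_cast; ring

/-- The half-edges of the empty vertices of degree `j` are `j` times as many as these vertices. -/
lemma expect_pairOne_emptyOfDeg {c : Config deg} (hi : c.Intact) {h : HalfEdge deg}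
    (hv : h.1 ∉ c.empty) (hh : h ∈ c.unpaired) (hU : 2 ≤ c.unpaired.card) (j : ℕ) :
    expect (c.pairOne h) (fun a => ((a.emptyOfDeg j).card : ℝ))
      = (c.emptyOfDeg j).card - j * (c.emptyOfDeg j).card / ((c.unpaired.card : ℝ) - 1) := by
  have hpos : (0 : ℝ) < (c.unpaired.card : ℝ) - 1 := by
    have : (2 : ℝ) ≤ c.unpaired.card := by exact_mod_cast hU
    linarith
  have e := Finset.card_erase_add_one hh
  have e' : ((c.unpaired.erase h).card : ℝ) = (c.unpaired.card : ℝ) - 1 := by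
    rw [← e]; push_cast; ring
  have hpair : ∀ g, (((c.pair h g).emptyOfDeg j).card : ℝ)
      = (c.emptyOfDeg j).card - if g.1 ∈ c.emptyOfDeg j then 1 else 0 := by
    intro g
    have h1 : (c.pair h g).emptyOfDeg j = (c.emptyOfDeg j).erase g.1 := by
      simp only [emptyOfDeg, pair, Finset.filter_erase]
    rw [h1]
    split_ifs with hg
    · rw [← Finset.card_erase_add_one hg]; push_cast; ring
    · rw [Finset.erase_eq_of_notMem hg]; ring
  have hset : (c.unpaired.erase h).filter (fun g => g.1 ∈ c.emptyOfDeg j)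
      = (c.emptyOfDeg j).sigma fun _ => Finset.univ := by
    ext g
    simp only [Finset.mem_filter, Finset.mem_erase, Finset.mem_sigma, Finset.mem_univ, and_true]
    refine ⟨fun H => H.2, fun H => ⟨⟨?_, ?_⟩, H⟩⟩
    · rintro rfl; exact hv (Finset.mem_filter.1 H).1
    · exact hi g (Finset.mem_filter.1 H).1
  have hcard : ((c.unpaired.erase h).filter (fun g => g.1 ∈ c.emptyOfDeg j)).card
      = j * (c.emptyOfDeg j).card := by
    rw [hset, Finset.card_sigma, Finset.sum_congr rfl (g := fun _ => j)]
    · simp [mul_comm]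
    · intro i hi'
      simpa using (Finset.mem_filter.1 hi').2
  rw [expect_pairOne hh hU]
  simp only [hpair]
  rw [Finset.sum_sub_distrib, Finset.sum_const, nsmul_eq_mul, e', sub_div,
    mul_div_cancel_left₀ _ hpos.ne', Finset.sum_boole, hcard]
  push_cast; rfl

lemma mul_card_emptyOfDeg_le {c : Config deg} (hi : c.Intact) (j : ℕ) :
    j * (c.emptyOfDeg j).card ≤ c.unpaired.card := by
  have h1 : ((c.emptyOfDeg j).sigma fun i : Fin N => (Finset.univ : Finset (Fin (deg i)))).card
      = j * (c.emptyOfDeg j).card := by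
    rw [Finset.card_sigma, Finset.sum_congr rfl (g := fun _ => j)]
    · simp [mul_comm]
    · intro i hi'
      simpa using (Finset.mem_filter.1 hi').2
  rw [← h1]
  refine Finset.card_le_card fun g hg => hi g ?_
  exact (Finset.mem_filter.1 (Finset.mem_sigma.1 hg).1).1

lemma emptyOfDeg_mono {c c' : Config deg} (h : c'.empty ⊆ c.empty) (j : ℕ) :
    c'.emptyOfDeg j ⊆ c.emptyOfDeg j := Finset.filter_subset_filter _ h

lemma card_emptyOfDeg_le_add {c c' : Config deg} (h : c'.empty ⊆ c.empty) (j : ℕ) :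
    (c.emptyOfDeg j).card + c'.empty.card ≤ (c'.emptyOfDeg j).card + c.empty.card := by
  have h1 : c.emptyOfDeg j ⊆ c'.emptyOfDeg j ∪ (c.empty \ c'.empty) := by
    intro i hi
    obtain ⟨a, b⟩ := Finset.mem_filter.1 hi
    by_cases hi' : i ∈ c'.empty
    · exact Finset.mem_union_left _ (Finset.mem_filter.2 ⟨hi', b⟩)
    · exact Finset.mem_union_right _ (Finset.mem_sdiff.2 ⟨a, hi'⟩)
  have h2 := (Finset.card_le_card h1).trans (Finset.card_union_le _ _)
  have h3 := Finset.card_sdiff_add_card_eq_card h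
  omega

/-- Averaging over the selected vertex. -/
lemma abs_expect_step_sub_le {f : Config deg → ℝ} {δ : Fin N → ℝ} {ρ η : ℝ} {c : Config deg}
    (hi : c.Intact) (hne : c.empty.Nonempty)
    (hf : ∀ v ∈ c.empty, f (c.select v) = f c - δ v)
    (hl : ∀ v ∈ c.empty, |expect (pairList (halfEdges deg v) (c.select v)) f - f (c.select v)
      + ρ * live (halfEdges deg v).toFinset (c.select v)| ≤ η) :
    |expect c.step f - f c - (-(∑ v ∈ c.empty, δ v) - ρ * ∑ v ∈ c.empty, (deg v : ℝ))
      / c.empty.card| ≤ η := by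
  have hpos : (0 : ℝ) < c.empty.card := by exact_mod_cast hne.card_pos
  have hlive : ∀ v ∈ c.empty, live (halfEdges deg v).toFinset (c.select v) = deg v := by
    intro v hv
    have : (halfEdges deg v).toFinset ∩ (c.select v).unpaired = (halfEdges deg v).toFinset := by
      refine Finset.inter_eq_left.2 fun h hh => hi h ?_
      rw [List.mem_toFinset, mem_halfEdges] at hh
      rwa [hh]
    rw [live, this, List.toFinset_card_of_nodup (nodup_halfEdges v), length_halfEdges]
  rw [step, dif_pos hne, expect_bind, expect_uniformOfFinset]
  have key : (∑ v ∈ c.empty, expect (pairList (halfEdges deg v) (c.select v)) f) / c.empty.card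
      - f c - (-(∑ v ∈ c.empty, δ v) - ρ * ∑ v ∈ c.empty, (deg v : ℝ)) / c.empty.card
      = (∑ v ∈ c.empty, (expect (pairList (halfEdges deg v) (c.select v)) f - f (c.select v)
      + ρ * live (halfEdges deg v).toFinset (c.select v))) / c.empty.card := by
    have hsum : ∑ v ∈ c.empty, (expect (pairList (halfEdges deg v) (c.select v)) f
        - f (c.select v) + ρ * live (halfEdges deg v).toFinset (c.select v))
        = ∑ v ∈ c.empty, (expect (pairList (halfEdges deg v) (c.select v)) f
        - f c + δ v + ρ * deg v) :=
      Finset.sum_congr rfl fun v hv => by rw [hlive v hv, hf v hv]; ring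
    rw [hsum, Finset.sum_add_distrib, Finset.sum_add_distrib, Finset.sum_sub_distrib, Finset.sum_const,
      ← Finset.mul_sum, nsmul_eq_mul]
    field_simp
    ring
  rw [key, abs_div, abs_of_pos hpos, div_le_iff₀ hpos]
  calc _ ≤ ∑ v ∈ c.empty, _ := Finset.abs_sum_le_sum_abs _ _
    _ ≤ ∑ v ∈ c.empty, η := Finset.sum_le_sum hl
    _ = η * c.empty.card := by rw [Finset.sum_const, nsmul_eq_mul, mul_comm]

/-- The integer state `(S, U, E(0), …, E(D))`. -/
def count (D : ℕ) (c : Config deg) : State D :=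
  ((c.indep.card : ℝ), (c.unpaired.card : ℝ), fun j => ((c.emptyOfDeg j).card : ℝ))

lemma card_emptyOfDeg_eq_sum (c : Config deg) (j : ℕ) :
    ((c.emptyOfDeg j).card : ℝ) = ∑ v ∈ c.empty, if deg v = j then 1 else 0 := by
  rw [Finset.sum_boole, emptyOfDeg]

lemma sum_count {D : ℕ} (hD : ∀ i, deg i ≤ D) (c : Config deg) :
    ∑ k, (c.count D).2.2 k = c.empty.card := by
  simp only [count, card_emptyOfDeg_eq_sum]
  rw [Finset.sum_comm, Finset.card_eq_sum_ones]
  push_cast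
  refine Finset.sum_congr rfl fun v _ => ?_
  rw [Finset.sum_eq_single (⟨deg v, Nat.lt_succ_of_le (hD v)⟩ : Fin (D + 1))]
  · simp
  · intro j _ hj
    exact if_neg fun h => hj (Fin.ext h.symm)
  · simp

lemma halfEdgeMass_count {D : ℕ} (hD : ∀ i, deg i ≤ D) (c : Config deg) :
    halfEdgeMass (c.count D).2.2 = ∑ v ∈ c.empty, (deg v : ℝ) := by
  simp only [count, card_emptyOfDeg_eq_sum, halfEdgeMass, Finset.mul_sum]
  rw [Finset.sum_comm]
  refine Finset.sum_congr rfl fun v _ => ?_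
  rw [Finset.sum_eq_single (⟨deg v, Nat.lt_succ_of_le (hD v)⟩ : Fin (D + 1))]
  · simp
  · intro j _ hj
    rw [if_neg fun h => hj (Fin.ext h.symm), mul_zero]
  · simp

/-- The constant in the error of the drift approximation. -/
def driftConst (D : ℕ) : ℝ := D * ((2 * D + 1 + D * (D + 1)) * 2 + 4 * D)

lemma card_select_unpaired_bounds {D : ℕ} {c a : Config deg} (hU : 4 * D + 2 ≤ c.unpaired.card)
    {v : Fin N} {k : ℕ} (hk : k ≤ D) (ha : PairBound k (c.select v) a) :
    2 ≤ a.unpaired.card ∧ (c.unpaired.card : ℝ) / 2 ≤ (a.unpaired.card : ℝ) - 1 := by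
  have h1 := ha.card_unpaired
  simp only [select] at h1
  have h2 : c.unpaired.card + 2 ≤ 2 * a.unpaired.card := by omega
  refine ⟨by omega, ?_⟩
  have h3 : (c.unpaired.card : ℝ) + 2 ≤ 2 * a.unpaired.card := by exact_mod_cast h2
  linarith

lemma driftConst_bound {D n : ℕ} (hn : n ≤ D) {U ε : ℝ} (hU : 0 < U)
    (hε : ε ≤ (2 * D + 1 + D * (D + 1)) * 2 / U) :
    n * (ε + 2 * D / (U / 2)) ≤ driftConst D / U := by
  have h1 : (n : ℝ) ≤ D := by exact_mod_cast hn
  have h2 : 2 * (D : ℝ) / (U / 2) = 4 * D / U := by field_simp; ring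
  rw [h2]
  calc n * (ε + 4 * D / U)
      ≤ n * ((2 * D + 1 + D * (D + 1)) * 2 / U + 4 * D / U) := by gcongr
    _ ≤ D * ((2 * D + 1 + D * (D + 1)) * 2 / U + 4 * D / U) := by gcongr
    _ = driftConst D / U := by rw [driftConst]; ring

lemma abs_expect_step_unpaired_le {D : ℕ} (hD : ∀ i, deg i ≤ D) {c : Config deg}
    (hi : c.Intact) (hne : c.empty.Nonempty) (hU : 4 * D + 2 ≤ c.unpaired.card) :
    |expect c.step (fun a => (a.unpaired.card : ℝ)) - c.unpaired.card
      - uRate (c.count D).2.2| ≤ driftConst D / c.unpaired.card := by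
  have hUpos : (0 : ℝ) < c.unpaired.card := by exact_mod_cast (by omega : 0 < c.unpaired.card)
  have := abs_expect_step_sub_le (f := fun a => (a.unpaired.card : ℝ)) (δ := fun _ => 0) (ρ := 2)
    (η := driftConst D / c.unpaired.card) hi hne (by simp [select]) ?_
  · rw [uRate, sum_count hD, halfEdgeMass_count hD]
    convert this using 4
    simp
  · intro v hv
    refine (abs_expect_pairList_sub_le (ε := 0) (m := c.unpaired.card / 2) (K := D)
      (by norm_num) le_rfl (by positivity)
      (fun k hk a ha => card_select_unpaired_bounds hU hk ha) ?_ _ (nodup_halfEdges v)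
      (fun h => mem_halfEdges.1) (k := 0) (by simpa [length_halfEdges] using hD v)
      (PairBound.refl _) (hi.select v) (Finset.notMem_erase _ _)).trans ?_
    · intro k hk a h ha _ _ _ hh
      rw [expect_pairOne_unpaired hh (card_select_unpaired_bounds hU hk ha).1]
      simp
    · rw [length_halfEdges]
      exact driftConst_bound (hD v) hUpos (by positivity)

/-- Replacing the ratio of current half-edges by the initial ratio. -/
lemma abs_div_sub_div_le {a a₀ u u₀ m A B : ℝ} (hm : 0 < m) (ha : a ≤ a₀) (ha' : a₀ ≤ a + A)
    (hu : u ≤ u₀) (hu' : u₀ ≤ u + B) (hmu : m ≤ u) (h0 : 0 ≤ a₀) (hau : a₀ ≤ u₀) (hA : 0 ≤ A)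
    (hB : 0 ≤ B) : |a / u - a₀ / u₀| ≤ (B + A) / m := by
  have hup : 0 < u := hm.trans_le hmu
  have hup0 : 0 < u₀ := hup.trans_le hu
  have h1 : a₀ / u₀ ≤ 1 := div_le_one_of_le₀ hau hup0.le
  have h1' : 0 ≤ a₀ / u₀ := div_nonneg h0 hup0.le
  have h2 : a / u - a₀ / u₀ = ((a - a₀) + (a₀ / u₀) * (u₀ - u)) / u := by
    field_simp; ring
  have h3 : |(a - a₀) + (a₀ / u₀) * (u₀ - u)| ≤ B + A := by
    have h4 : 0 ≤ (a₀ / u₀) * (u₀ - u) := mul_nonneg h1' (by linarith)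
    have h5 : (a₀ / u₀) * (u₀ - u) ≤ 1 * (u₀ - u) := mul_le_mul_of_nonneg_right h1 (by linarith)
    rw [abs_le]; constructor <;> linarith
  rw [h2, abs_div, abs_of_pos hup]
  gcongr

lemma abs_expect_step_emptyOfDeg_le {D : ℕ} (hD : ∀ i, deg i ≤ D) {c : Config deg}
    (hi : c.Intact) (hne : c.empty.Nonempty) (hU : 4 * D + 2 ≤ c.unpaired.card)
    (j : Fin (D + 1)) :
    |expect c.step (fun a => ((a.emptyOfDeg j).card : ℝ)) - (c.emptyOfDeg j).card
      - eRate (c.count D).2.1 (c.count D).2.2 j| ≤ driftConst D / c.unpaired.card := by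
  have hUpos : (0 : ℝ) < c.unpaired.card := by exact_mod_cast (by omega : 0 < c.unpaired.card)
  have hjE := mul_card_emptyOfDeg_le hi (j : ℕ)
  have hjE' : ((j : ℕ) : ℝ) * (c.emptyOfDeg j).card ≤ c.unpaired.card := by exact_mod_cast hjE
  have hj : ((j : ℕ) : ℝ) ≤ D := by exact_mod_cast Nat.lt_succ_iff.1 j.2
  set ρ : ℝ := ((j : ℕ) : ℝ) * (c.emptyOfDeg j).card / c.unpaired.card with hρ
  have hρ0 : 0 ≤ ρ := by positivity
  have hρ1 : ρ ≤ 1 := div_le_one_of_le₀ hjE' hUpos.le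
  have := abs_expect_step_sub_le (f := fun a => ((a.emptyOfDeg j).card : ℝ))
    (δ := fun v => if deg v = j then 1 else 0) (ρ := ρ)
    (η := driftConst D / c.unpaired.card) hi hne ?_ ?_
  · rw [eRate, sum_count hD, halfEdgeMass_count hD]
    convert this using 4
    simp only [count]
    rw [← card_emptyOfDeg_eq_sum, hρ]
  · intro v hv
    have h1 : (c.select v).emptyOfDeg j = (c.emptyOfDeg j).erase v := by
      simp only [emptyOfDeg, select, Finset.filter_erase]
    simp only [h1]
    split_ifs with hvj
    · rw [← Finset.card_erase_add_one (s := c.emptyOfDeg j) (a := v)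
        (Finset.mem_filter.2 ⟨hv, hvj⟩)]
      push_cast; ring
    · rw [Finset.erase_eq_of_notMem (s := c.emptyOfDeg j) (a := v)
        fun h => hvj (Finset.mem_filter.1 h).2]
      ring
  · intro v hv
    have hε : (0 : ℝ) ≤ (2 * D + 1 + D * (D + 1)) * 2 / c.unpaired.card := by positivity
    refine (abs_expect_pairList_sub_le (ε := (2 * D + 1 + D * (D + 1)) * 2 / c.unpaired.card)
      (m := c.unpaired.card / 2) (K := D)
      (by rw [abs_of_nonneg hρ0]; linarith) hε (by positivity)
      (fun k hk a ha => card_select_unpaired_bounds hU hk ha) ?_ _ (nodup_halfEdges v)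
      (fun h => mem_halfEdges.1) (k := 0) (by simpa [length_halfEdges] using hD v)
      (PairBound.refl _) (hi.select v) (Finset.notMem_erase _ _)).trans ?_
    · intro k hk a h ha hai hva hhv hh
      obtain ⟨hb1, hb2⟩ := card_select_unpaired_bounds hU hk ha
      rw [expect_pairOne_emptyOfDeg hai (by rwa [hhv]) hh hb1]
      have e1 := Finset.card_le_card ha.unpaired
      have e2 := ha.card_unpaired
      have e3 : a.empty ⊆ c.empty := ha.empty.trans (Finset.erase_subset _ _)
      have e4 := Finset.card_le_card (emptyOfDeg_mono e3 j)
      have e5 := card_emptyOfDeg_le_add e3 j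
      have e6 := ha.card_empty
      have e7 := Finset.card_erase_add_one hv
      simp only [select] at e1 e2 e6
      have f1 : (a.unpaired.card : ℝ) ≤ c.unpaired.card := by exact_mod_cast e1
      have f2 : (c.unpaired.card : ℝ) ≤ a.unpaired.card + 2 * D := by
        exact_mod_cast (by omega : c.unpaired.card ≤ a.unpaired.card + 2 * D)
      have f3 : ((a.emptyOfDeg j).card : ℝ) ≤ (c.emptyOfDeg j).card := by exact_mod_cast e4
      have f4 : ((c.emptyOfDeg j).card : ℝ) ≤ (a.emptyOfDeg j).card + (D + 1) := by
        exact_mod_cast (by omega : (c.emptyOfDeg j).card ≤ (a.emptyOfDeg j).card + (D + 1))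
      have := abs_div_sub_div_le (a := (j : ℕ) * (a.emptyOfDeg j).card)
        (a₀ := (j : ℕ) * (c.emptyOfDeg j).card) (u := (a.unpaired.card : ℝ) - 1)
        (u₀ := c.unpaired.card) (m := c.unpaired.card / 2) (A := D * (D + 1)) (B := 2 * D + 1)
        (by positivity) (by gcongr)
        (by
          calc ((j : ℕ) : ℝ) * (c.emptyOfDeg j).card
              ≤ (j : ℕ) * ((a.emptyOfDeg j).card + (D + 1)) := by gcongr
            _ = (j : ℕ) * (a.emptyOfDeg j).card + (j : ℕ) * (D + 1) := by ring
            _ ≤ _ := by gcongr)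
        (by linarith) (by linarith) hb2 (by positivity) hjE' (by positivity) (by positivity)
      rw [abs_sub_comm] at this
      refine le_trans (le_of_eq ?_) (this.trans (le_of_eq ?_))
      · congr 1; rw [hρ]; ring
      · field_simp
    · rw [length_halfEdges]
      exact driftConst_bound (hD v) hUpos le_rfl

end Config

/-! ### Concentration for finite Markov chains -/

/-- `X` has the Markov property with the transition probabilities `κ`. -/
structure IsMarkovChain {Ω α : Type*} [MeasurableSpace Ω] (P : Measure Ω) (κ : α → PMF α)
    (X : ℕ → Ω → α) : Prop where
  measurable : ∀ n a, MeasurableSet (X n ⁻¹' {a})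
  law : ∀ (n : ℕ) (w : ℕ → α), P {ω | ∀ m ≤ n + 1, X m ω = w m}
    = P {ω | ∀ m ≤ n, X m ω = w m} * κ (w n) (w (n + 1))

section Chain

variable {Ω : Type*} [MeasurableSpace Ω] {P : Measure Ω}

lemma setLIntegral_eq_sum_preimage {ι : Type*} [Fintype ι] {Y : Ω → ι}
    (hY : ∀ i, MeasurableSet (Y ⁻¹' {i})) {s : Set Ω} (hs : MeasurableSet s) (F : Ω → ENNReal) :
    ∫⁻ ω in s, F ω ∂P = ∑ i, ∫⁻ ω in s ∩ Y ⁻¹' {i}, F ω ∂P := by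
  rw [← tsum_fintype (L := SummationFilter.unconditional ι),
    ← lintegral_iUnion (fun i => hs.inter (hY i)), ← Set.inter_iUnion]
  · congr 2
    ext ω
    simp
  · intro i j hij
    refine Set.disjoint_left.2 fun ω h1 h2 => hij ?_
    exact (Set.mem_singleton_iff.1 h1.2).symm.trans h2.2

/-- The sum of the centred increments of `f`. -/
noncomputable def noise {α : Type*} [Fintype α] (κ : α → PMF α) (f : α → ℝ) (w : ℕ → α)
    (n : ℕ) : ℝ :=
  ∑ m ∈ Finset.range n, (f (w (m + 1)) - expect (κ (w m)) f)

namespace IsMarkovChain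

variable {α : Type*} [Fintype α] {κ : α → PMF α} {X : ℕ → Ω → α}

lemma measurable_comp₂ (h : IsMarkovChain P κ X) {β : Type*} [MeasurableSpace β] (n : ℕ)
    (g : α → α → β) : Measurable fun ω => g (X n ω) (X (n + 1) ω) := by
  let _ : MeasurableSpace α := ⊤
  have : DiscreteMeasurableSpace α := ⟨fun _ => trivial⟩
  have h1 : Measurable fun ω => (X n ω, X (n + 1) ω) :=
    (measurable_to_countable' (h.measurable n)).prodMk
      (measurable_to_countable' (h.measurable (n + 1)))
  exact (Measurable.of_discrete (f := fun a : α × α => g a.1 a.2)).comp h1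

/-- Integrating out the last step. -/
lemma lintegral_mul_le (h : IsMarkovChain P κ X) {n : ℕ} {G : Ω → ENNReal}
    (hG : ∀ ω ω', (∀ m ≤ n, X m ω = X m ω') → G ω = G ω') {g : α → α → ENNReal} {r : ENNReal}
    (hg : ∀ a, ∑ b, κ a b * g a b ≤ r) :
    ∫⁻ ω, G ω * g (X n ω) (X (n + 1) ω) ∂P ≤ r * ∫⁻ ω, G ω ∂P := by
  classical
  let Y : Ω → Fin (n + 1) → α := fun ω m => X m ω
  have hY : ∀ w : Fin (n + 1) → α, Y ⁻¹' {w} = {ω | ∀ m ≤ n, X m ω = w (Fin.ofNat (n + 1) m)} := by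
    intro w
    ext ω
    simp only [Set.mem_preimage, Set.mem_singleton_iff, Set.mem_ofPred_eq, funext_iff, Y]
    constructor
    · intro H m hm
      have := H (Fin.ofNat (n + 1) m)
      rwa [Fin.val_ofNat, Nat.mod_eq_of_lt (Nat.lt_succ_of_le hm)] at this
    · intro H m
      have := H m (Nat.lt_succ_iff.1 m.2)
      simpa using this
  have hYm : ∀ w, MeasurableSet (Y ⁻¹' {w}) := by
    intro w
    have : Y ⁻¹' {w} = ⋂ m : Fin (n + 1), X m ⁻¹' {w m} := by
      ext ω; simp [Y, funext_iff]
    rw [this]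
    exact MeasurableSet.iInter fun m => h.measurable m _
  rw [← setLIntegral_univ, ← setLIntegral_univ (f := G),
    setLIntegral_eq_sum_preimage hYm MeasurableSet.univ,
    setLIntegral_eq_sum_preimage hYm MeasurableSet.univ, Finset.mul_sum]
  refine Finset.sum_le_sum fun w _ => ?_
  rw [Set.univ_inter]
  rcases (Y ⁻¹' {w}).eq_empty_or_nonempty with he | ⟨ω₀, hω₀⟩
  · simp [he]
  have hconst : ∀ ω ∈ Y ⁻¹' {w}, G ω = G ω₀ := fun ω hω => hG _ _ fun m hm => by
    rw [hY] at hω hω₀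
    rw [hω m hm, hω₀ m hm]
  have hlast : ∀ ω ∈ Y ⁻¹' {w}, X n ω = X n ω₀ := fun ω hω => by
    rw [hY] at hω hω₀
    rw [hω n le_rfl, hω₀ n le_rfl]
  have hmeas : ∀ b, P (Y ⁻¹' {w} ∩ X (n + 1) ⁻¹' {b}) = P (Y ⁻¹' {w}) * κ (X n ω₀) b := by
    intro b
    have := h.law n fun m => if m ≤ n then X m ω₀ else b
    simp only [le_refl, if_true, show ¬ n + 1 ≤ n by omega, if_false] at this
    rw [hY] at hω₀ ⊢
    convert this using 2
    · ext ω
      simp only [Set.mem_inter_iff, Set.mem_ofPred_eq, Set.mem_preimage, Set.mem_singleton_iff]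
      constructor
      · rintro ⟨H1, H2⟩ m hm
        split_ifs with hmn
        · rw [H1 m hmn, hω₀ m hmn]
        · rwa [show m = n + 1 by omega]
      · intro H
        refine ⟨fun m hm => ?_, ?_⟩
        · have := H m (by omega)
          rw [if_pos hm] at this
          rw [this, hω₀ m hm]
        · have := H (n + 1) le_rfl
          rwa [if_neg (by omega)] at this
    · congr 1
      ext ω
      simp only [Set.mem_ofPred_eq]
      refine forall₂_congr fun m hm => ?_
      rw [if_pos hm, hω₀ m hm]
  have hR : ∫⁻ ω in Y ⁻¹' {w}, G ω ∂P = G ω₀ * P (Y ⁻¹' {w}) := by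
    rw [setLIntegral_congr_fun (hYm w) hconst, setLIntegral_const]
  have hL : ∀ b, ∫⁻ ω in Y ⁻¹' {w} ∩ X (n + 1) ⁻¹' {b}, G ω * g (X n ω) (X (n + 1) ω) ∂P
      = G ω₀ * P (Y ⁻¹' {w}) * (κ (X n ω₀) b * g (X n ω₀) b) := by
    intro b
    have : ∀ ω ∈ Y ⁻¹' {w} ∩ X (n + 1) ⁻¹' {b},
        G ω * g (X n ω) (X (n + 1) ω) = G ω₀ * g (X n ω₀) b := fun ω hω => by
      rw [hconst ω hω.1, hlast ω hω.1, show X (n + 1) ω = b from hω.2]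
    rw [setLIntegral_congr_fun ((hYm w).inter (h.measurable _ _)) this, setLIntegral_const, hmeas]
    ring
  rw [setLIntegral_eq_sum_preimage (h.measurable (n + 1)) (hYm w),
    Finset.sum_congr rfl fun b _ => hL b, ← Finset.mul_sum, hR, mul_comm r]
  gcongr
  exact hg _

lemma ae_mem_support (h : IsMarkovChain P κ X) :
    ∀ᵐ ω ∂P, ∀ n, X (n + 1) ω ∈ (κ (X n ω)).support := by
  classical
  rw [ae_all_iff]
  intro n
  have h1 := h.lintegral_mul_le (n := n) (G := fun _ => 1) (fun _ _ _ => rfl)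
    (g := fun a b => if b ∈ (κ a).support then 0 else 1) (r := 0) fun a => by
      refine (Finset.sum_eq_zero fun b _ => ?_).le
      split_ifs with hb
      · simp
      · rw [PMF.mem_support_iff, not_not] at hb
        simp [hb]
  simp only [one_mul, zero_mul, nonpos_iff_eq_zero] at h1
  rw [lintegral_eq_zero_iff
    (h.measurable_comp₂ n fun a b => if b ∈ (κ a).support then (0 : ENNReal) else 1)] at h1
  filter_upwards [h1] with ω hω
  by_contra hn
  simp [hn] at hω

lemma measurable_noise (h : IsMarkovChain P κ X) (f : α → ℝ) (n : ℕ) :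
    Measurable fun ω => noise κ f (X · ω) n :=
  Finset.measurable_sum _ fun m _ => h.measurable_comp₂ m fun a b => f b - expect (κ a) f

lemma expect_exp_le {q : PMF α} {f : α → ℝ} {K θ : ℝ} (hθ : 0 ≤ θ) (hθK : θ * K ≤ 1)
    (hK : ∀ b ∈ q.support, |f b - expect q f| ≤ K) :
    expect q (fun b => Real.exp (θ * (f b - expect q f))) ≤ Real.exp ((θ * K) ^ 2) := by
  have h1 : expect q (fun b => Real.exp (θ * (f b - expect q f)))
      ≤ expect q fun b => (1 + (θ * K) ^ 2 - θ * expect q f) - (-θ) * f b := by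
    refine expect_mono fun b hb => ?_
    have h2 : |θ * (f b - expect q f)| ≤ θ * K := by
      rw [abs_mul, abs_of_nonneg hθ]
      exact mul_le_mul_of_nonneg_left (hK b hb) hθ
    have h3 := (abs_le.1 (Real.abs_exp_sub_one_sub_id_le (h2.trans hθK))).2
    have h4 : (θ * (f b - expect q f)) ^ 2 ≤ (θ * K) ^ 2 := by
      rw [← sq_abs (θ * (f b - expect q f))]
      exact pow_le_pow_left₀ (abs_nonneg _) h2 2
    linarith
  rw [expect_sub, expect_const, expect_mul_left] at h1
  refine h1.trans ?_
  have := Real.add_one_le_exp ((θ * K) ^ 2)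
  linarith

lemma lintegral_exp_noise_le [IsProbabilityMeasure P] (h : IsMarkovChain P κ X) {f : α → ℝ}
    {K θ : ℝ} (hθ : 0 ≤ θ) (hθK : θ * K ≤ 1)
    (hK : ∀ a, ∀ b ∈ (κ a).support, |f b - expect (κ a) f| ≤ K) (n : ℕ) :
    ∫⁻ ω, ENNReal.ofReal (Real.exp (θ * noise κ f (X · ω) n)) ∂P
      ≤ ENNReal.ofReal (Real.exp (n * (θ * K) ^ 2)) := by
  induction n with
  | zero => simp [noise]
  | succ n ih =>
    have h1 := h.lintegral_mul_le (n := n)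
      (G := fun ω => ENNReal.ofReal (Real.exp (θ * noise κ f (X · ω) n)))
      (fun ω ω' hω => by
        have : noise κ f (X · ω) n = noise κ f (X · ω') n :=
          Finset.sum_congr rfl fun m hm => by
            rw [Finset.mem_range] at hm
            simp only [hω m hm.le, hω (m + 1) hm]
        simp only [this])
      (g := fun a b => ENNReal.ofReal (Real.exp (θ * (f b - expect (κ a) f))))
      (r := ENNReal.ofReal (Real.exp ((θ * K) ^ 2))) fun a => by
        refine le_trans (le_of_eq ?_) (ENNReal.ofReal_le_ofReal (expect_exp_le hθ hθK (hK a)))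
        conv_rhs => rw [expect]
        rw [ENNReal.ofReal_sum_of_nonneg fun b _ => by positivity]
        refine Finset.sum_congr rfl fun b _ => ?_
        rw [ENNReal.ofReal_mul ENNReal.toReal_nonneg, ENNReal.ofReal_toReal ((κ a).apply_ne_top b)]
    have h2 : ∀ ω, ENNReal.ofReal (Real.exp (θ * noise κ f (X · ω) (n + 1)))
        = ENNReal.ofReal (Real.exp (θ * noise κ f (X · ω) n))
          * ENNReal.ofReal (Real.exp (θ * (f (X (n + 1) ω) - expect (κ (X n ω)) f))) := by
      intro ω
      rw [← ENNReal.ofReal_mul (Real.exp_nonneg _), ← Real.exp_add, noise, Finset.sum_range_succ,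
        noise, mul_add]
    simp only [h2]
    refine h1.trans ((mul_le_mul_right ih _).trans (le_of_eq ?_))
    rw [← ENNReal.ofReal_mul (Real.exp_nonneg _), ← Real.exp_add]
    push_cast
    ring_nf

lemma measure_le_noise_le [IsProbabilityMeasure P] (h : IsMarkovChain P κ X) {f : α → ℝ}
    {K θ : ℝ} (hθ : 0 ≤ θ) (hθK : θ * K ≤ 1)
    (hK : ∀ a, ∀ b ∈ (κ a).support, |f b - expect (κ a) f| ≤ K) (n : ℕ) (y : ℝ) :
    P {ω | y ≤ noise κ f (X · ω) n} ≤ ENNReal.ofReal (Real.exp (n * (θ * K) ^ 2 - θ * y)) := by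
  have hm : Measurable fun ω => ENNReal.ofReal (Real.exp (θ * noise κ f (X · ω) n)) :=
    ((h.measurable_noise f n).const_mul θ).exp.ennreal_ofReal
  have h1 := mul_meas_ge_le_lintegral (μ := P) hm (ENNReal.ofReal (Real.exp (θ * y)))
  have h2 := h1.trans (h.lintegral_exp_noise_le hθ hθK hK n)
  have h3 : P {ω | y ≤ noise κ f (X · ω) n}
      ≤ P {ω | ENNReal.ofReal (Real.exp (θ * y))
        ≤ ENNReal.ofReal (Real.exp (θ * noise κ f (X · ω) n))} := by
    refine measure_mono fun ω hω => ?_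
    refine ENNReal.ofReal_le_ofReal (Real.exp_le_exp.2 ?_)
    exact mul_le_mul_of_nonneg_left hω hθ
  have h4 : ENNReal.ofReal (Real.exp (-(θ * y))) * ENNReal.ofReal (Real.exp (θ * y)) = 1 := by
    rw [← ENNReal.ofReal_mul (Real.exp_nonneg _), ← Real.exp_add]
    simp
  calc P {ω | y ≤ noise κ f (X · ω) n}
      ≤ ENNReal.ofReal (Real.exp (-(θ * y))) * (ENNReal.ofReal (Real.exp (θ * y)) * P {ω |
        ENNReal.ofReal (Real.exp (θ * y))
        ≤ ENNReal.ofReal (Real.exp (θ * noise κ f (X · ω) n))}) := by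
        rw [← mul_assoc, h4, one_mul]; exact h3
    _ ≤ ENNReal.ofReal (Real.exp (-(θ * y))) * ENNReal.ofReal (Real.exp (n * (θ * K) ^ 2)) := by
        gcongr
    _ = _ := by
        rw [← ENNReal.ofReal_mul (Real.exp_nonneg _), ← Real.exp_add]
        ring_nf

/-- The exponential rate of the tail bound, with `θ = ε / (2 K²)` in the preceding estimate. -/
lemma measure_noise_ge_le [IsProbabilityMeasure P] (h : IsMarkovChain P κ X) {f : α → ℝ}
    {K ε : ℝ} (hε : 0 < ε) (hεK : ε ≤ K)
    (hK : ∀ a, ∀ b ∈ (κ a).support, |f b - expect (κ a) f| ≤ K) {n N : ℕ} (hn : n ≤ N) :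
    P {ω | ε * N ≤ noise κ f (X · ω) n}
      ≤ ENNReal.ofReal (Real.exp (-(ε ^ 2 / (4 * K ^ 2)) * N)) := by
  have hKpos : 0 < K := hε.trans_le hεK
  refine (h.measure_le_noise_le (θ := ε / (2 * K ^ 2)) (by positivity) ?_ hK n _).trans
    (ENNReal.ofReal_le_ofReal (Real.exp_le_exp.2 ?_))
  · rw [show ε / (2 * K ^ 2) * K = ε / (2 * K) by field_simp]
    exact div_le_one_of_le₀ (by linarith) (by positivity)
  · have h1 : (n : ℝ) ≤ N := by exact_mod_cast hn
    have h2 : (ε / (2 * K ^ 2) * K) ^ 2 = ε ^ 2 / (4 * K ^ 2) := by field_simp; ring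
    have h3 : ε / (2 * K ^ 2) * (ε * N) = 2 * (ε ^ 2 / (4 * K ^ 2)) * N := by field_simp; ring
    rw [h2, h3]
    have h4 : 0 ≤ ε ^ 2 / (4 * K ^ 2) := by positivity
    nlinarith

lemma noise_neg (f : α → ℝ) (w : ℕ → α) (n : ℕ) :
    noise κ (fun a => -f a) w n = -noise κ f w n := by
  simp only [noise, expect_neg, ← Finset.sum_neg_distrib]
  exact Finset.sum_congr rfl fun m _ => by ring

end IsMarkovChain

/-- The law of large numbers for the noise of a sequence of chains on one probability space.  The
exponential bounds are summable, so that the joint law is irrelevant. -/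
theorem ae_eventually_abs_noise_le [IsProbabilityMeasure P] {α : ℕ → Type*} [∀ N, Fintype (α N)]
    {κ : ∀ N, α N → PMF (α N)} {X : ∀ N, ℕ → Ω → α N} (h : ∀ N, IsMarkovChain P (κ N) (X N))
    {f : ∀ N, α N → ℝ} {K : ℝ}
    (hK : ∀ N a, ∀ b ∈ (κ N a).support, |f N b - expect (κ N a) (f N)| ≤ K) :
    ∀ᵐ ω ∂P, ∀ ε : ℝ, 0 < ε →
      ∀ᶠ N in atTop, ∀ n ≤ N, |noise (κ N) (f N) (X N · ω) n| ≤ ε * N := by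
  have key : ∀ ε : ℝ, 0 < ε → ∀ᵐ ω ∂P,
      ∀ᶠ N in atTop, ∀ n ≤ N, |noise (κ N) (f N) (X N · ω) n| ≤ ε * N := by
    intro ε hε
    have hK' : ∀ N a, ∀ b ∈ (κ N a).support, |f N b - expect (κ N a) (f N)| ≤ max K ε :=
      fun N a b hb => (hK N a b hb).trans (le_max_left _ _)
    have hK'' : ∀ N a, ∀ b ∈ (κ N a).support,
        |-f N b - expect (κ N a) (fun a => -f N a)| ≤ max K ε := fun N a b hb => by
      rw [expect_neg, ← abs_neg]
      convert hK' N a b hb using 2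
      ring
    set r : ℝ := ε ^ 2 / (4 * max K ε ^ 2) with hr
    have hrpos : 0 < r := by
      have : 0 < max K ε := hε.trans_le (le_max_right _ _)
      positivity
    let B : ℕ → Set Ω := fun N => ⋃ n ∈ Finset.range (N + 1),
      ({ω | ε * N ≤ noise (κ N) (f N) (X N · ω) n}
        ∪ {ω | ε * N ≤ noise (κ N) (fun a => -f N a) (X N · ω) n})
    have hB : ∀ N, P (B N) ≤ ENNReal.ofReal (2 * ((N + 1) * Real.exp (-r * N))) := by
      intro N
      refine (measure_biUnion_finset_le _ _).trans ?_
      refine (Finset.sum_le_sum (g := fun _ => ENNReal.ofReal (2 * Real.exp (-r * N)))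
        fun n hn => ?_).trans (le_of_eq ?_)
      · have hn' : n ≤ N := Nat.lt_succ_iff.1 (Finset.mem_range.1 hn)
        refine (measure_union_le _ _).trans ?_
        rw [two_mul, ENNReal.ofReal_add (Real.exp_nonneg _) (Real.exp_nonneg _)]
        exact add_le_add ((h N).measure_noise_ge_le hε (le_max_right _ _) (hK' N) hn')
          ((h N).measure_noise_ge_le hε (le_max_right _ _) (hK'' N) hn')
      · rw [Finset.sum_const, Finset.card_range, nsmul_eq_mul, ← ENNReal.ofReal_natCast,
          ← ENNReal.ofReal_mul (Nat.cast_nonneg _)]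
        congr 1
        push_cast; ring
    have hsum : Summable fun N : ℕ => 2 * (((N : ℝ) + 1) * Real.exp (-r * N)) := by
      refine Summable.mul_left 2 ?_
      have h1 := Real.summable_pow_mul_exp_neg_nat_mul 1 hrpos
      have h0 := Real.summable_pow_mul_exp_neg_nat_mul 0 hrpos
      refine (h1.add h0).congr fun N => ?_
      simp only [pow_one, pow_zero]
      ring
    have hfin : ∑' N, P (B N) ≠ ⊤ := by
      refine ne_top_of_le_ne_top ?_ (ENNReal.tsum_le_tsum hB)
      exact hsum.tsum_ofReal_ne_top
    filter_upwards [ae_eventually_notMem hfin] with ω hω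
    filter_upwards [hω] with N hN n hn
    simp only [B, Set.mem_iUnion, Set.mem_union, Set.mem_ofPred_eq, not_exists, not_or, not_le] at hN
    obtain ⟨h1, h2⟩ := hN n (Finset.mem_range.2 (Nat.lt_succ_of_le hn))
    rw [IsMarkovChain.noise_neg] at h2
    rw [abs_le]
    constructor <;> linarith
  have hall : ∀ᵐ ω ∂P, ∀ k : ℕ, ∀ᶠ N in atTop, ∀ n ≤ N,
      |noise (κ N) (f N) (X N · ω) n| ≤ (1 / ((k : ℝ) + 1)) * N :=
    ae_all_iff.2 fun k => key _ (by positivity)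
  filter_upwards [hall] with ω hω ε hε
  obtain ⟨k, hk⟩ := exists_nat_one_div_lt hε
  filter_upwards [hω k] with N hN n hn
  exact (hN n hn).trans (by gcongr)

end Chain

/-! ### Comparison of a recursion with a differential equation -/

lemma norm_sub_sub_sum_le {E : Type*} [NormedAddCommGroup E] [NormedSpace ℝ E] {b : E → E}
    {x : ℝ → E} {T₁ η A : ℝ} {N : ℕ} (hN : 0 < (N : ℝ)) (hη : (N : ℝ)⁻¹ < η)
    (hx : ContinuousOn x (Set.Icc 0 T₁))
    (hxd : ∀ r ∈ Set.Ico 0 T₁, HasDerivWithinAt x (b (x r)) (Set.Ici r) r)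
    (hη' : ∀ r ∈ Set.Icc 0 T₁, ∀ q ∈ Set.Icc 0 T₁, dist r q < η → dist (b (x r)) (b (x q)) < A)
    {n : ℕ} (hn : (n : ℝ) ≤ N * T₁) :
    ‖x (n / N) - x 0 - (N : ℝ)⁻¹ • ∑ m ∈ Finset.range n, b (x (m / N))‖ ≤ A * (n / N) := by
  induction n with
  | zero => simp
  | succ n ih =>
    push_cast at hn
    have h0 : (0 : ℝ) ≤ n / N := by positivity
    have h1 : ((n : ℝ) + 1) / N ≤ T₁ := by rw [div_le_iff₀ hN]; linarith
    have h2 : ((n : ℝ) + 1) / N = n / N + (N : ℝ)⁻¹ := by field_simp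
    have hinv : 0 < (N : ℝ)⁻¹ := inv_pos.2 hN
    have hle : (n : ℝ) / N ≤ (n + 1) / N := by rw [h2]; linarith
    have hsub : Set.Icc ((n : ℝ) / N) ((n + 1) / N) ⊆ Set.Icc 0 T₁ := Set.Icc_subset_Icc h0 h1
    have key := norm_image_sub_le_of_norm_deriv_right_le_segment
      (f := fun r => x r - r • b (x (n / N))) (f' := fun r => b (x r) - b (x (n / N))) (C := A)
      (a := (n : ℝ) / N) (b := (n + 1) / N)
      ((hx.mono hsub).sub (continuousOn_id.smul continuousOn_const))
      (fun r hr => by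
        have h3 := (hasDerivWithinAt_id r (Set.Ici r)).smul_const (b (x (n / N)))
        rw [one_smul] at h3
        exact (hxd r ⟨h0.trans hr.1, hr.2.trans_le h1⟩).sub h3)
      (fun r hr => by
        rw [← dist_eq_norm]
        refine (hη' r (hsub ⟨hr.1, hr.2.le⟩) _ (hsub ⟨le_rfl, hle⟩) ?_).le
        rw [Real.dist_eq, abs_of_nonneg (by linarith [hr.1])]
        linarith [hr.2])
      ((n + 1) / N) ⟨hle, le_rfl⟩
    have ih' := ih (by linarith)
    have e : x (((n + 1 : ℕ) : ℝ) / N) - x 0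
          - (N : ℝ)⁻¹ • ∑ m ∈ Finset.range (n + 1), b (x (m / N))
        = (x (n / N) - x 0 - (N : ℝ)⁻¹ • ∑ m ∈ Finset.range n, b (x (m / N)))
          + ((x ((n + 1) / N) - ((n + 1) / N : ℝ) • b (x (n / N)))
            - (x (n / N) - (n / N : ℝ) • b (x (n / N)))) := by
      rw [Finset.sum_range_succ, smul_add, h2, add_smul]
      push_cast
      rw [h2]
      abel
    rw [e]
    refine (norm_add_le _ _).trans ((add_le_add ih' key).trans (le_of_eq ?_))
    push_cast
    rw [h2]
    ring

/-- A sequence of recursions, whose increments are asymptotically those of the Euler scheme of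
`x' = b x` up to a uniformly small error, stays close to the solution `x`.  The increments need to
be controlled only on compact subsets of the domain `O`, because a discrete Grönwall estimate keeps
the recursion in a compact neighbourhood of the path. -/
theorem eventually_norm_sub_le_of_increments {E : Type*} [NormedAddCommGroup E] [NormedSpace ℝ E]
    [ProperSpace E] {b : E → E} {O : Set E} (hO : IsOpen O)
    (hb : ∀ C ⊆ O, LocallyLipschitzOn C b) {x : ℝ → E} {T₁ : ℝ} (hT₁ : T₁ ≤ 1)
    (hx : ContinuousOn x (Set.Icc 0 T₁))
    (hxd : ∀ r ∈ Set.Ico 0 T₁, HasDerivWithinAt x (b (x r)) (Set.Ici r) r)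
    (hxO : ∀ r ∈ Set.Icc 0 T₁, x r ∈ O) {X d : ℕ → ℕ → E}
    (h0 : Tendsto (fun N => X N 0) atTop (𝓝 (x 0)))
    (hz : ∀ ε : ℝ, 0 < ε → ∀ᶠ N : ℕ in atTop, ∀ n ≤ N,
      ‖X N n - X N 0 - (N : ℝ)⁻¹ • ∑ m ∈ Finset.range n, d N m‖ ≤ ε)
    (hd : ∀ C ⊆ O, IsCompact C → ∀ ε : ℝ, 0 < ε → ∀ᶠ N : ℕ in atTop, ∀ m, X N m ∈ C →
      ‖d N m - b (X N m)‖ ≤ ε)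
    {ε : ℝ} (hε : 0 < ε) :
    ∀ᶠ N : ℕ in atTop, ∀ n : ℕ, (n : ℝ) ≤ N * T₁ → ‖X N n - x (n / N)‖ ≤ ε := by
  have hC₀ : IsCompact (x '' Set.Icc 0 T₁) := isCompact_Icc.image_of_continuousOn hx
  obtain ⟨δ, hδ, hδO⟩ := hC₀.exists_cthickening_subset_open hO (Set.image_subset_iff.2 hxO)
  set C := Metric.cthickening δ (x '' Set.Icc 0 T₁) with hC
  have hCc : IsCompact C := hC₀.cthickening
  obtain ⟨K, hK⟩ := (hb C hδO).exists_lipschitzOnWith_of_compact hCc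
  have hxC : ∀ r ∈ Set.Icc 0 T₁, x r ∈ C := fun r hr =>
    Metric.self_subset_cthickening _ (Set.mem_image_of_mem x hr)
  have hbx : ContinuousOn (fun r => b (x r)) (Set.Icc 0 T₁) := hK.continuousOn.comp hx hxC
  set A : ℝ := min ε δ / Real.exp K with hA
  have hApos : 0 < A := div_pos (lt_min hε hδ) (Real.exp_pos _)
  have hAK : A * Real.exp K = min ε δ := div_mul_cancel₀ _ (Real.exp_pos _).ne'
  obtain ⟨η, hη, hη'⟩ := Metric.uniformContinuousOn_iff.1
    (isCompact_Icc.uniformContinuousOn_of_continuous hbx) (A / 4) (by positivity)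
  have hinv : ∀ᶠ N : ℕ in atTop, (N : ℝ)⁻¹ < η :=
    (tendsto_inv_atTop_nhds_zero_nat (𝕜 := ℝ)).eventually (gt_mem_nhds hη)
  have h0' : ∀ᶠ N : ℕ in atTop, ‖X N 0 - x 0‖ < A / 4 := by
    have := Metric.tendsto_nhds.1 h0 (A / 4) (by positivity)
    simpa only [dist_eq_norm] using this
  filter_upwards [hinv, h0', hz (A / 4) (by positivity), hd C hδO hCc (A / 4) (by positivity),
    eventually_gt_atTop 0] with N hN1 hN2 hN3 hN4 hN5
  have hN : (0 : ℝ) < N := by exact_mod_cast hN5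
  have hq : ∀ n : ℕ, (n : ℝ) ≤ N * T₁ → (1 + (K : ℝ) / N) ^ n ≤ Real.exp K := by
    intro n hn
    have h1 : (1 + (K : ℝ) / N) ^ n ≤ Real.exp (K / N) ^ n := by
      refine pow_le_pow_left₀ (by positivity) ?_ n
      rw [add_comm]
      exact Real.add_one_le_exp _
    refine h1.trans ?_
    rw [← Real.exp_nat_mul]
    refine Real.exp_le_exp.2 ?_
    have h2 : (n : ℝ) ≤ N := hn.trans (by nlinarith)
    rw [← mul_div_assoc, div_le_iff₀ hN, mul_comm]
    gcongr
  have claim : ∀ n : ℕ, (n : ℝ) ≤ N * T₁ →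
      ‖X N n - x (n / N)‖ ≤ A * (1 + (K : ℝ) / N) ^ n := by
    intro n
    induction n using Nat.strong_induction_on with
    | _ n ih =>
    intro hn
    have hnN : n ≤ N := by
      have : (n : ℝ) ≤ N := hn.trans (by nlinarith)
      exact_mod_cast this
    have hm : ∀ m < n, (m : ℝ) ≤ N * T₁ := fun m hmn => by
      have : (m : ℝ) ≤ n := by exact_mod_cast hmn.le
      linarith
    have hmem : ∀ m < n, (m : ℝ) / N ∈ Set.Icc 0 T₁ := fun m hmn =>
      ⟨by positivity, by rw [div_le_iff₀ hN]; linarith [hm m hmn]⟩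
    have hXC : ∀ m < n, X N m ∈ C := by
      intro m hmn
      refine Metric.mem_cthickening_of_dist_le _ (x (m / N)) _ _
        (Set.mem_image_of_mem x (hmem m hmn)) ?_
      rw [dist_eq_norm]
      calc _ ≤ A * (1 + (K : ℝ) / N) ^ m := ih m hmn (hm m hmn)
        _ ≤ A * Real.exp K := by
          have := hq m (hm m hmn)
          gcongr
        _ ≤ δ := by rw [hAK]; exact min_le_right _ _
    have e1 := hN3 n hnN
    have e2 : ‖(N : ℝ)⁻¹ • ∑ m ∈ Finset.range n, (d N m - b (X N m))‖ ≤ A / 4 := by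
      rw [norm_smul, norm_inv, Real.norm_of_nonneg hN.le, inv_mul_le_iff₀ hN]
      refine (norm_sum_le_of_le _ fun m hmr => hN4 m (hXC m (Finset.mem_range.1 hmr))).trans ?_
      rw [Finset.sum_const, Finset.card_range, nsmul_eq_mul]
      have : (n : ℝ) ≤ N := by exact_mod_cast hnN
      gcongr
    have e3 : ‖(N : ℝ)⁻¹ • ∑ m ∈ Finset.range n, (b (X N m) - b (x (m / N)))‖
        ≤ A * ((1 + (K : ℝ) / N) ^ n - 1) := by
      rw [norm_smul, norm_inv, Real.norm_of_nonneg hN.le, inv_mul_le_iff₀ hN]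
      refine (norm_sum_le_of_le (f := fun m => b (X N m) - b (x (m / N)))
        (n := fun m => K * (A * (1 + (K : ℝ) / N) ^ m)) _ fun m hmr => ?_).trans (le_of_eq ?_)
      · have hmn := Finset.mem_range.1 hmr
        refine (hK.norm_sub_le (hXC m hmn) (hxC _ (hmem m hmn))).trans ?_
        have := ih m hmn (hm m hmn)
        gcongr
      · rw [← geom_sum_mul, ← Finset.mul_sum, ← Finset.mul_sum]
        field_simp
        ring
    have e4 : ‖x (n / N) - x 0 - (N : ℝ)⁻¹ • ∑ m ∈ Finset.range n, b (x (m / N))‖ ≤ A / 4 := by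
      refine (norm_sub_sub_sum_le hN hN1 hx hxd hη' hn).trans ?_
      have : (n : ℝ) / N ≤ 1 := div_le_one_of_le₀ (by exact_mod_cast hnN) hN.le
      nlinarith
    have e : X N n - x (n / N)
        = (X N n - X N 0 - (N : ℝ)⁻¹ • ∑ m ∈ Finset.range n, d N m) + (X N 0 - x 0)
          + (N : ℝ)⁻¹ • ∑ m ∈ Finset.range n, (d N m - b (X N m))
          + (N : ℝ)⁻¹ • ∑ m ∈ Finset.range n, (b (X N m) - b (x (m / N)))
          - (x (n / N) - x 0 - (N : ℝ)⁻¹ • ∑ m ∈ Finset.range n, b (x (m / N))) := by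
      simp only [Finset.sum_sub_distrib, smul_sub]
      abel
    rw [e]
    refine (norm_sub_le _ _).trans ?_
    have f1 := norm_add_le ((X N n - X N 0 - (N : ℝ)⁻¹ • ∑ m ∈ Finset.range n, d N m)
      + (X N 0 - x 0) + (N : ℝ)⁻¹ • ∑ m ∈ Finset.range n, (d N m - b (X N m)))
      ((N : ℝ)⁻¹ • ∑ m ∈ Finset.range n, (b (X N m) - b (x (m / N))))
    have f2 := norm_add₃_le (a := X N n - X N 0 - (N : ℝ)⁻¹ • ∑ m ∈ Finset.range n, d N m)
      (b := X N 0 - x 0) (c := (N : ℝ)⁻¹ • ∑ m ∈ Finset.range n, (d N m - b (X N m)))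
    linarith
  intro n hn
  calc _ ≤ A * (1 + (K : ℝ) / N) ^ n := claim n hn
    _ ≤ A * Real.exp K := by
      have := hq n hn
      gcongr
    _ ≤ ε := by rw [hAK]; exact min_le_left _ _

namespace Config

variable {N : ℕ} {deg : Fin N → ℕ} {D : ℕ}

/-! ### Trajectories of the algorithm -/

/-- A sequence of configurations with the transitions of the algorithm. -/
structure IsTrajectory (w : ℕ → Config deg) : Prop where
  zero : w 0 = initial deg
  step : ∀ n, w (n + 1) ∈ (w n).step.support

lemma stepBound_or_eq (hD : ∀ i, deg i ≤ D) {c c' : Config deg} (hc : c' ∈ c.step.support) :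
    StepBound D c c' ∧ c.empty.Nonempty ∨ c' = c ∧ c.empty = ∅ := by
  rcases mem_support_step hc with ⟨h1, h2⟩ | ⟨v, hv, hc⟩
  · exact Or.inr ⟨h2, h1⟩
  · exact Or.inl ⟨(stepBound_of_mem_support hD hv hc).1, v, hv⟩

lemma Reachable.card_indep_step (hD : ∀ i, deg i ≤ D) {c c' : Config deg} (h : c.Reachable)
    (hne : c.empty.Nonempty) (hc : c' ∈ c.step.support) :
    c'.indep.card = c.indep.card + 1 := by
  rcases mem_support_step hc with ⟨h1, -⟩ | ⟨v, hv, hc⟩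
  · exact absurd h1 hne.ne_empty
  · rw [(stepBound_of_mem_support hD hv hc).2, Finset.card_insert_of_notMem]
    exact fun h' => Finset.disjoint_left.1 h.disjoint h' hv

lemma abs_unpaired_step_le (hD : ∀ i, deg i ≤ D) {c c' : Config deg}
    (hc : c' ∈ c.step.support) :
    |(c'.unpaired.card : ℝ) - c.unpaired.card| ≤ 2 * D := by
  rcases stepBound_or_eq hD hc with ⟨h, -⟩ | ⟨rfl, -⟩
  · have h1 : (c'.unpaired.card : ℝ) ≤ c.unpaired.card := by
      exact_mod_cast Finset.card_le_card h.unpaired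
    have h2 : (c.unpaired.card : ℝ) ≤ c'.unpaired.card + 2 * D := by exact_mod_cast h.card_unpaired
    rw [abs_le]; constructor <;> linarith
  · simp

lemma abs_emptyOfDeg_step_le (hD : ∀ i, deg i ≤ D) {c c' : Config deg}
    (hc : c' ∈ c.step.support) (j : ℕ) :
    |((c'.emptyOfDeg j).card : ℝ) - (c.emptyOfDeg j).card| ≤ D + 1 := by
  rcases stepBound_or_eq hD hc with ⟨h, -⟩ | ⟨rfl, -⟩
  · have h1 : ((c'.emptyOfDeg j).card : ℝ) ≤ (c.emptyOfDeg j).card := by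
      exact_mod_cast Finset.card_le_card (emptyOfDeg_mono h.empty j)
    have h2 := card_emptyOfDeg_le_add h.empty j
    have h3 := h.card_empty
    have h4 : ((c.emptyOfDeg j).card : ℝ) ≤ (c'.emptyOfDeg j).card + (D + 1) := by
      exact_mod_cast (by omega : (c.emptyOfDeg j).card ≤ (c'.emptyOfDeg j).card + (D + 1))
    rw [abs_le]; constructor <;> linarith
  · simp only [sub_self, abs_zero]
    positivity

namespace IsTrajectory

variable {w : ℕ → Config deg}

lemma reachable (h : IsTrajectory w) (n : ℕ) : (w n).Reachable := by
  induction n with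
  | zero => rw [h.zero]; exact reachable_initial
  | succ n ih => exact ih.of_mem_support_step (h.step n)

/-- After time `k` all changes are controlled by the number of empty vertices at time `k`. -/
lemma bounds (h : IsTrajectory w) (hD : ∀ i, deg i ≤ D) {k n : ℕ} (hkn : k ≤ n) :
    (w n).empty ⊆ (w k).empty ∧ (w n).unpaired.card ≤ (w k).unpaired.card ∧
      (w k).indep.card ≤ (w n).indep.card ∧
      (w n).indep.card + (w n).empty.card ≤ (w k).indep.card + (w k).empty.card ∧
      (w k).unpaired.card + 2 * D * (w k).indep.card
        ≤ (w n).unpaired.card + 2 * D * (w n).indep.card := by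
  induction n, hkn using Nat.le_induction with
  | base => exact ⟨subset_rfl, le_rfl, le_rfl, le_rfl, le_rfl⟩
  | succ n hkn ih =>
    rcases stepBound_or_eq hD (h.step n) with ⟨hs, hne⟩ | ⟨he, -⟩
    · obtain ⟨h1, h2, h3, h4, h5⟩ := ih
      have e := (h.reachable n).card_indep_step hD hne (h.step n)
      have e1 := hs.card_empty_lt
      have e2 := hs.card_unpaired
      have e3 := Finset.card_le_card hs.unpaired
      refine ⟨hs.empty.trans h1, e3.trans h2, by omega, by omega, ?_⟩
      rw [e, mul_add]
      omega
    · rwa [he]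

lemma norm_count_sub_le (h : IsTrajectory w) (hD : ∀ i, deg i ≤ D) {k n : ℕ} (hkn : k ≤ n) :
    ‖(w n).count D - (w k).count D‖ ≤ (2 * D + 1) * (w k).empty.card := by
  obtain ⟨h1, h2, h3, h4, h5⟩ := h.bounds hD hkn
  have f2 : ((w n).unpaired.card : ℝ) ≤ (w k).unpaired.card := by exact_mod_cast h2
  have f3 : ((w k).indep.card : ℝ) ≤ (w n).indep.card := by exact_mod_cast h3
  have f4 : ((w n).indep.card : ℝ) ≤ (w k).indep.card + (w k).empty.card := by
    exact_mod_cast (by omega : (w n).indep.card ≤ (w k).indep.card + (w k).empty.card)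
  have f5 : ((w k).unpaired.card : ℝ) + 2 * D * (w k).indep.card
      ≤ (w n).unpaired.card + 2 * D * (w n).indep.card := by exact_mod_cast h5
  have hDE : (0 : ℝ) ≤ 2 * D * (w k).empty.card := by positivity
  have hE : (0 : ℝ) ≤ (w k).empty.card := by positivity
  refine norm_prod_le_iff.2 ⟨?_, norm_prod_le_iff.2 ⟨?_, ?_⟩⟩
  · simp only [count, Prod.fst_sub, Real.norm_eq_abs, abs_le]
    constructor <;> linarith
  · simp only [count, Prod.fst_sub, Prod.snd_sub, Real.norm_eq_abs, abs_le]
    have : 2 * (D : ℝ) * (w n).indep.card ≤ 2 * D * ((w k).indep.card + (w k).empty.card) := by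
      gcongr
    constructor <;> linarith
  · refine (pi_norm_le_iff_of_nonneg (by positivity)).2 fun j => ?_
    have g1 : (((w n).emptyOfDeg j).card : ℝ) ≤ ((w k).emptyOfDeg j).card := by
      exact_mod_cast Finset.card_le_card (emptyOfDeg_mono h1 j)
    have g2 : (((w k).emptyOfDeg j).card : ℝ) ≤ (w k).empty.card := by
      exact_mod_cast Finset.card_filter_le _ _
    have g3 : (0 : ℝ) ≤ ((w n).emptyOfDeg j).card := by positivity
    simp only [count, Prod.snd_sub, Pi.sub_apply, Real.norm_eq_abs, abs_le]
    constructor <;> linarith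

/-- When there are few half-edges, almost every step selects a vertex without blocking any. -/
lemma few_blocked (h : IsTrajectory w) (hD : ∀ i, deg i ≤ D) (n : ℕ) :
    N + (w n).unpaired.card ≤ (w n).empty.card + (w n).indep.card + (w 0).unpaired.card ∧
      ((w n).indep.card = n ∨ (w n).empty = ∅ ∧ (w n).indep.card ≤ n) := by
  induction n with
  | zero => simp [h.zero, initial]
  | succ n ih =>
    obtain ⟨h1, h2⟩ := ih
    rcases stepBound_or_eq hD (h.step n) with ⟨hs, hne⟩ | ⟨he, he'⟩
    · have e := (h.reachable n).card_indep_step hD hne (h.step n)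
      have e1 := hs.card_add
      refine ⟨by omega, Or.inl ?_⟩
      rcases h2 with h2 | ⟨h2, -⟩
      · omega
      · exact absurd h2 hne.ne_empty
    · rw [he]
      refine ⟨h1, Or.inr ⟨he', ?_⟩⟩
      rcases h2 with h2 | h2 <;> omega

lemma norm_count_sub_le_of_le (h : IsTrajectory w) (hD : ∀ i, deg i ≤ D) {n : ℕ} (hn : n ≤ N) :
    ‖(w n).count D - ((n : ℝ), 0, fun i => if i = 0 then (N : ℝ) - n else 0)‖
      ≤ 2 * (w 0).unpaired.card := by
  obtain ⟨h1, h2⟩ := h.few_blocked hD n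
  obtain ⟨b1, b2, b3, b4, b5⟩ := h.bounds hD (Nat.zero_le n)
  have hi := (h.reachable n).intact
  have e0 : (w 0).indep.card + (w 0).empty.card = N := by simp [h.zero, initial]
  rw [e0] at b4
  have f1 : (N : ℝ) + (w n).unpaired.card
      ≤ (w n).empty.card + (w n).indep.card + (w 0).unpaired.card := by exact_mod_cast h1
  have f2 : ((w n).unpaired.card : ℝ) ≤ (w 0).unpaired.card := by exact_mod_cast b2
  have f3 : ((w n).indep.card : ℝ) + (w n).empty.card ≤ N := by exact_mod_cast b4
  have fU : (0 : ℝ) ≤ (w n).unpaired.card := by positivity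
  have hn' : (n : ℝ) ≤ N := by exact_mod_cast hn
  have f4 : ((w n).indep.card : ℝ) ≤ n ∧ (n : ℝ) ≤ (w n).indep.card + (w 0).unpaired.card := by
    rcases h2 with h2 | ⟨h2, h3⟩
    · rw [h2]; constructor <;> linarith
    · have : ((w n).indep.card : ℝ) ≤ n := by exact_mod_cast h3
      rw [h2, Finset.card_empty, Nat.cast_zero] at f1
      constructor <;> linarith
  refine norm_prod_le_iff.2 ⟨?_, norm_prod_le_iff.2 ⟨?_, ?_⟩⟩
  · simp only [count, Prod.fst_sub, Real.norm_eq_abs, abs_le]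
    constructor <;> linarith
  · simp only [count, Prod.fst_sub, Prod.snd_sub, Real.norm_eq_abs, abs_le]
    constructor <;> linarith
  · refine (pi_norm_le_iff_of_nonneg (by positivity)).2 fun j => ?_
    simp only [count, Prod.snd_sub, Pi.sub_apply, Real.norm_eq_abs, abs_le]
    by_cases hj : j = 0
    · subst hj
      have g1 : (((w n).emptyOfDeg 0).card : ℝ) ≤ (w n).empty.card := by
        exact_mod_cast Finset.card_filter_le _ _
      have g2 : (w n).empty.card ≤ ((w n).emptyOfDeg 0).card + (w n).unpaired.card := by
        have h3 : ((w n).empty.filter fun i => deg i ≠ 0).card ≤ (w n).unpaired.card := by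
          have h4 : ((w n).empty.filter fun i => deg i ≠ 0) ⊆
              (w n).unpaired.image Sigma.fst := by
            intro i hi'
            obtain ⟨a, b⟩ := Finset.mem_filter.1 hi'
            exact Finset.mem_image.2 ⟨⟨i, ⟨0, Nat.pos_of_ne_zero b⟩⟩, hi _ a, rfl⟩
          exact (Finset.card_le_card h4).trans Finset.card_image_le
        have h5 := Finset.card_filter_add_card_filter_not (s := (w n).empty) (fun i => deg i = 0)
        simp only [emptyOfDeg]
        simp only [ne_eq] at h3
        omega
      have g3 : ((w n).empty.card : ℝ) ≤ ((w n).emptyOfDeg 0).card + (w n).unpaired.card := by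
        exact_mod_cast g2
      simp only [if_true, Fin.val_zero]
      constructor <;> linarith
    · have g1 : ((j : ℕ) : ℝ) * ((w n).emptyOfDeg j).card ≤ (w n).unpaired.card := by
        exact_mod_cast mul_card_emptyOfDeg_le hi (j : ℕ)
      have g2 : (1 : ℝ) ≤ (j : ℕ) := by
        exact_mod_cast Nat.one_le_iff_ne_zero.2 fun h => hj (Fin.ext h)
      have g3 : (0 : ℝ) ≤ ((w n).emptyOfDeg j).card := by positivity
      have g4 : (((w n).emptyOfDeg j).card : ℝ) ≤ (j : ℕ) * ((w n).emptyOfDeg j).card :=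
        le_mul_of_one_le_left g3 g2
      simp only [if_neg hj]
      constructor <;> linarith

end IsTrajectory

/-! ### Rescaling -/

lemma rescaled_eq (D : ℕ) (c : Config deg) : rescaled D c = (N : ℝ)⁻¹ • c.count D := by
  refine Prod.ext ?_ (Prod.ext ?_ (funext fun j => ?_)) <;>
  simp only [rescaled, count, emptyOfDeg, Prod.smul_fst, Prod.smul_snd, Pi.smul_apply,
    smul_eq_mul, div_eq_inv_mul]

lemma halfEdgeMass_smul (a : ℝ) (e : Fin (D + 1) → ℝ) :
    halfEdgeMass (a • e) = a * halfEdgeMass e := by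
  simp only [halfEdgeMass, Pi.smul_apply, smul_eq_mul, Finset.mul_sum]
  exact Finset.sum_congr rfl fun k _ => by ring

lemma uRate_smul {a : ℝ} (ha : a ≠ 0) (e : Fin (D + 1) → ℝ) : uRate (a • e) = uRate e := by
  rw [uRate, uRate, halfEdgeMass_smul]
  simp only [Pi.smul_apply, smul_eq_mul, ← Finset.mul_sum]
  rw [show -2 * (a * halfEdgeMass e) = a * (-2 * halfEdgeMass e) by ring,
    mul_div_mul_left _ _ ha]

lemma eRate_smul {a : ℝ} (ha : a ≠ 0) (u : ℝ) (e : Fin (D + 1) → ℝ) (i : Fin (D + 1)) :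
    eRate (a * u) (a • e) i = eRate u e i := by
  rw [eRate, eRate, halfEdgeMass_smul]
  simp only [Pi.smul_apply, smul_eq_mul, ← Finset.mul_sum]
  rw [show ((i : ℕ) : ℝ) * (a * e i) = a * ((i : ℕ) * e i) by ring, mul_div_mul_left _ _ ha,
    show -(a * e i) - (i : ℕ) * e i / u * (a * halfEdgeMass e)
      = a * (-e i - (i : ℕ) * e i / u * halfEdgeMass e) by ring, mul_div_mul_left _ _ ha]

/-- The expected increments of the integer state; the first component is the actual increment of
the independent set, which is `1` as long as there is an empty vertex. -/
noncomputable def meanIncr (D : ℕ) (w : ℕ → Config deg) (m : ℕ) : State D :=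
  (((w (m + 1)).indep.card : ℝ) - (w m).indep.card,
    expect (w m).step (fun a => (a.unpaired.card : ℝ)) - (w m).unpaired.card,
    fun j => expect (w m).step (fun a => ((a.emptyOfDeg j).card : ℝ)) - ((w m).emptyOfDeg j).card)

lemma sub_sub_sum_eq_noise {α : Type*} [Fintype α] (κ : α → PMF α) (f : α → ℝ) (w : ℕ → α)
    (n : ℕ) : f (w n) - f (w 0) - ∑ m ∈ Finset.range n, (expect (κ (w m)) f - f (w m))
      = noise κ f w n := by
  rw [noise, ← Finset.sum_range_sub (fun m => f (w m)), ← Finset.sum_sub_distrib]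
  exact Finset.sum_congr rfl fun m _ => by ring

lemma norm_rescaled_sub_le {w : ℕ → Config deg} {n : ℕ} {ε : ℝ} (hε : 0 ≤ ε) (hN : 0 < N)
    (hu : |noise step (fun a => (a.unpaired.card : ℝ)) w n| ≤ ε * N)
    (he : ∀ j : Fin (D + 1),
      |noise step (fun a => ((a.emptyOfDeg j).card : ℝ)) w n| ≤ ε * N) :
    ‖rescaled D (w n) - rescaled D (w 0)
      - (N : ℝ)⁻¹ • ∑ m ∈ Finset.range n, meanIncr D w m‖ ≤ ε := by
  have hN' : (0 : ℝ) < N := by exact_mod_cast hN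
  rw [rescaled_eq, rescaled_eq, ← smul_sub, ← smul_sub, norm_smul, norm_inv,
    Real.norm_of_nonneg hN'.le, inv_mul_le_iff₀ hN', mul_comm]
  refine norm_prod_le_iff.2 ⟨?_, norm_prod_le_iff.2 ⟨?_, ?_⟩⟩
  · simp only [count, Prod.fst_sub, Prod.fst_sum, meanIncr]
    rw [Finset.sum_range_sub (fun m => ((w m).indep.card : ℝ)), sub_self, norm_zero]
    positivity
  · simp only [count, Prod.fst_sub, Prod.snd_sub, Prod.fst_sum, Prod.snd_sum, meanIncr]
    rw [sub_sub_sum_eq_noise step (fun a => (a.unpaired.card : ℝ))]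
    exact hu
  · refine (pi_norm_le_iff_of_nonneg (by positivity)).2 fun j => ?_
    simp only [count, Prod.snd_sub, Prod.snd_sum, meanIncr, Pi.sub_apply, Finset.sum_apply]
    rw [sub_sub_sum_eq_noise step (fun a => ((a.emptyOfDeg j).card : ℝ))]
    exact he j

lemma norm_meanIncr_sub_drift_le (hD : ∀ i, deg i ≤ D) {w : ℕ → Config deg}
    (hw : IsTrajectory w) (hN : 0 < N) {m : ℕ} (hne : (w m).empty.Nonempty)
    (hU : 4 * D + 2 ≤ (w m).unpaired.card) :
    ‖meanIncr D w m - drift D (rescaled D (w m))‖ ≤ driftConst D / (w m).unpaired.card := by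
  have hN' : (N : ℝ)⁻¹ ≠ 0 := inv_ne_zero (by exact_mod_cast hN.ne')
  have hi := (hw.reachable m).intact
  have hu := abs_expect_step_unpaired_le hD hi hne hU
  have h0 := (abs_nonneg _).trans hu
  rw [rescaled_eq]
  refine norm_prod_le_iff.2 ⟨?_, norm_prod_le_iff.2 ⟨?_, ?_⟩⟩
  · simp only [meanIncr, drift, Prod.fst_sub]
    rw [(hw.reachable m).card_indep_step hD hne (hw.step m)]
    simpa using h0
  · simp only [meanIncr, drift, Prod.fst_sub, Prod.snd_sub, Prod.smul_snd]
    rw [uRate_smul hN']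
    exact hu
  · refine (pi_norm_le_iff_of_nonneg h0).2 fun j => ?_
    simp only [meanIncr, drift, Prod.snd_sub, Pi.sub_apply, Prod.smul_snd, Prod.smul_fst,
      smul_eq_mul]
    rw [eRate_smul hN']
    exact abs_expect_step_emptyOfDeg_le hD hi hne hU j

lemma rescaled_initial_unpaired (hD : ∀ i, deg i ≤ D) :
    (rescaled D (initial deg)).2.1 = halfEdgeMass (rescaled D (initial deg)).2.2 := by
  rw [rescaled_eq, Prod.smul_snd, Prod.smul_fst, Prod.smul_snd, halfEdgeMass_smul,
    halfEdgeMass_count hD, smul_eq_mul]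
  congr 1
  simp [count, initial]

end Config

/-! ### Convergence to the fluid path -/

section

variable {Ω : Type*} [MeasurableSpace Ω] {P : Measure Ω} {N : ℕ} {deg : Fin N → ℕ}
  {ξ : ℕ → Ω → Config deg}

lemma IsExploration.isMarkovChain (h : IsExploration P ξ) : IsMarkovChain P Config.step ξ where
  measurable := h.measurable
  law n w := by rw [h.law, h.law, Finset.prod_range_succ, mul_assoc]

lemma IsExploration.ae_isTrajectory [IsProbabilityMeasure P] (h : IsExploration P ξ) :
    ∀ᵐ ω ∂P, Config.IsTrajectory (ξ · ω) := by
  have h0 : ∀ᵐ ω ∂P, ξ 0 ω = Config.initial deg := by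
    have h1 := h.law 0 fun _ => Config.initial deg
    have h2 : {ω | ∀ m ≤ 0, ξ m ω = Config.initial deg} = ξ 0 ⁻¹' {Config.initial deg} := by
      ext ω; simp
    rw [h2, Finset.range_zero, Finset.prod_empty, mul_one, PMF.pure_apply_self] at h1
    exact (mem_ae_iff_prob_eq_one (h.measurable 0 _)).2 h1
  filter_upwards [h0, h.isMarkovChain.ae_mem_support] with ω h1 h2
  exact ⟨h1, h2⟩

end

section

variable {D : ℕ} {p : Fin (D + 1) → ℝ} {deg : (N : ℕ) → Fin N → ℕ}
  {w : (N : ℕ) → ℕ → Config (deg N)} {x : ℝ → State D} {t : Fin (D + 1) → ℝ} {T : ℝ}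

lemma tendsto_rescaled_zero (hdeg : ∀ N i, deg N i ≤ D)
    (hlim : ∀ j : Fin (D + 1),
      Tendsto (fun N : ℕ => ((Finset.univ.filter fun i => deg N i = (j : ℕ)).card : ℝ) / N)
        atTop (𝓝 (p j)))
    (hw : ∀ N, Config.IsTrajectory (w N)) :
    Tendsto (fun N => rescaled D (w N 0)) atTop (𝓝 (0, halfEdgeMass p, p)) := by
  have he : Tendsto (fun N => (rescaled D (w N 0)).2.2) atTop (𝓝 p) := by
    refine tendsto_pi_nhds.2 fun j => (hlim j).congr fun N => ?_
    simp [rescaled, (hw N).zero, Config.initial]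
  have hM : Continuous fun e : Fin (D + 1) → ℝ => halfEdgeMass e := by
    unfold halfEdgeMass; fun_prop
  have hu : Tendsto (fun N => (rescaled D (w N 0)).2.1) atTop (𝓝 (halfEdgeMass p)) := by
    refine ((hM.tendsto p).comp he).congr fun N => ?_
    simp only [Function.comp, (hw N).zero, Config.rescaled_initial_unpaired (hdeg N)]
  have hs : Tendsto (fun N => (rescaled D (w N 0)).1) atTop (𝓝 0) := by
    refine tendsto_const_nhds.congr fun N => ?_
    simp [rescaled, (hw N).zero, Config.initial]
  exact hs.prodMk_nhds (hu.prodMk_nhds he)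

/-- On compact sets of regular states the number of unpaired half-edges is of order `N`, so that
the error of the drift approximation vanishes. -/
lemma eventually_norm_meanIncr_sub_drift_le (hdeg : ∀ N i, deg N i ≤ D)
    (hw : ∀ N, Config.IsTrajectory (w N)) {C : Set (State D)} (hC : C ⊆ regular D)
    (hCc : IsCompact C) {ε : ℝ} (hε : 0 < ε) :
    ∀ᶠ N : ℕ in atTop, ∀ m, rescaled D (w N m) ∈ C →
      ‖Config.meanIncr D (w N) m - drift D (rescaled D (w N m))‖ ≤ ε := by
  obtain ⟨δ, hδ, hδC⟩ := hCc.exists_forall_le' (f := fun z : State D => z.2.1)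
    (by fun_prop) (a := 0) fun z hz => (hC hz).1
  have hlin : Tendsto (fun N : ℕ => δ * (N : ℝ)) atTop atTop :=
    tendsto_natCast_atTop_atTop.const_mul_atTop hδ
  filter_upwards [hlin.eventually_ge_atTop (4 * D + 2),
    hlin.eventually_ge_atTop (Config.driftConst D / ε), eventually_gt_atTop 0] with N h1 h2 h3 m hm
  have hN : (0 : ℝ) < N := by exact_mod_cast h3
  have hreg := hC hm
  have hU : δ * N ≤ ((w N m).unpaired.card : ℝ) := by
    have := hδC _ hm
    simp only [rescaled] at this
    rwa [le_div_iff₀ hN] at this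
  have hne : (w N m).empty.Nonempty := by
    rw [Finset.nonempty_iff_ne_empty]
    intro he
    have := hreg.2
    simp [rescaled, he] at this
  have hU' : 4 * D + 2 ≤ (w N m).unpaired.card := by exact_mod_cast h1.trans hU
  refine (Config.norm_meanIncr_sub_drift_le (hdeg N) (hw N) h3 hne hU').trans ?_
  have hpos : (0 : ℝ) < (w N m).unpaired.card := by exact_mod_cast (by omega)
  rw [div_le_iff₀ hpos]
  rw [div_le_iff₀ hε] at h2
  nlinarith

/-- The case of positive mean degree.  Up to a time `T₁ < T` the process follows the path by the
comparison theorem.  If `T₁` is close to `T`, then few empty vertices are left at time `T₁`, and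
they bound all later changes. -/
lemma eventually_norm_rescaled_sub_le (hx : IsFluidPath p x t T) (hT : 0 < T)
    (hu : ∀ r ∈ Set.Ico 0 T, 0 < (x r).2.1) (hdeg : ∀ N i, deg N i ≤ D)
    (hlim : ∀ j : Fin (D + 1),
      Tendsto (fun N : ℕ => ((Finset.univ.filter fun i => deg N i = (j : ℕ)).card : ℝ) / N)
        atTop (𝓝 (p j)))
    (hw : ∀ N, Config.IsTrajectory (w N))
    (hnu : ∀ ε : ℝ, 0 < ε → ∀ᶠ N in atTop, ∀ n ≤ N,
      |noise Config.step (fun a => (a.unpaired.card : ℝ)) (w N) n| ≤ ε * N)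
    (hne : ∀ j : Fin (D + 1), ∀ ε : ℝ, 0 < ε → ∀ᶠ N in atTop, ∀ n ≤ N,
      |noise Config.step (fun a => ((a.emptyOfDeg j).card : ℝ)) (w N) n| ≤ ε * N)
    {ε : ℝ} (hε : 0 < ε) :
    ∀ᶠ N : ℕ in atTop, ∀ n ≤ N, ‖rescaled D (w N n) - x (n / N)‖ ≤ ε := by
  set B : ℝ := (2 * D + 1) * (3 * (D + 1)) + 4 with hB
  have hBpos : 0 < B := by positivity
  set η : ℝ := ε / B with hη
  have hηpos : 0 < η := by positivity
  have hηB : B * η = ε := by rw [hη]; field_simp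
  have hηε : η ≤ ε := by
    rw [← hηB]
    refine le_mul_of_one_le_left hηpos.le ?_
    have : (0 : ℝ) ≤ (2 * D + 1) * (3 * (D + 1)) := by positivity
    linarith
  have hT1 := hx.T_mem.2
  obtain ⟨δ, hδ, hδx⟩ := Metric.uniformContinuousOn_iff.1
    (isCompact_Icc.uniformContinuousOn_of_continuous hx.cont) η hηpos
  have hδx' : ∀ r ∈ Set.Icc (0 : ℝ) 1, ∀ q ∈ Set.Icc (0 : ℝ) 1, |r - q| < δ →
      ‖x r - x q‖ ≤ η := fun r hr q hq h => by
    rw [← dist_eq_norm]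
    exact (hδx r hr q hq h).le
  obtain ⟨T₁, hT₁⟩ : ∃ T₁, max 0 (T - δ) < T₁ ∧ T₁ < T :=
    exists_between (max_lt hT (by linarith))
  have hT₁0 : 0 < T₁ := (le_max_left _ _).trans_lt hT₁.1
  have hT₁δ : T - δ < T₁ := (le_max_right _ _).trans_lt hT₁.1
  have hT₁m : T₁ ∈ Set.Icc (0 : ℝ) 1 := ⟨hT₁0.le, hT₁.2.le.trans hT1⟩
  have hTT : ‖x T₁ - x T‖ ≤ η := hδx' _ hT₁m _ hx.T_mem (by
    rw [abs_lt]; constructor <;> linarith [hT₁.2])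
  -- after `T₁` the path stays close to its final value
  have htail : ∀ r ∈ Set.Icc T₁ 1, ‖x T - x r‖ ≤ η := by
    intro r hr
    rcases le_total T r with h | h
    · rw [hx.stopped r ⟨h, hr.2⟩, sub_self, norm_zero]
      exact hηpos.le
    · exact hδx' _ hx.T_mem _ ⟨hT₁0.le.trans hr.1, hr.2⟩ (by
        rw [abs_lt]; constructor <;> linarith [hr.1])
  have hcomp := eventually_norm_sub_le_of_increments (b := drift D) (O := regular D) (x := x)
    (T₁ := T₁) (X := fun N m => rescaled D (w N m)) (d := fun N m => Config.meanIncr D (w N) m)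
    (isOpen_regular D) (fun C hC => locallyLipschitzOn_drift hC) hT₁m.2
    (hx.cont.mono (Set.Icc_subset_Icc_right hT₁m.2))
    (fun r hr => hx.hasDerivWithinAt_Ici ⟨hr.1, hr.2.trans hT₁.2⟩)
    (fun r hr => ⟨hu r ⟨hr.1, hr.2.trans_lt hT₁.2⟩, hx.sum_pos ⟨hr.1, hr.2.trans_lt hT₁.2⟩⟩)
    (by rw [hx.init]; exact tendsto_rescaled_zero hdeg hlim hw)
    (fun ε' hε' => by
      filter_upwards [hnu ε' hε', eventually_all.2 fun j => hne j ε' hε', eventually_gt_atTop 0]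
        with N h1 h2 h3 n hn
      exact Config.norm_rescaled_sub_le hε'.le h3 (h1 n hn) fun j => h2 j n hn)
    (fun C hC hCc ε' hε' => eventually_norm_meanIncr_sub_drift_le hdeg hw hC hCc hε') hηpos
  have hinv : ∀ᶠ N : ℕ in atTop, (N : ℝ)⁻¹ < δ :=
    (tendsto_inv_atTop_nhds_zero_nat (𝕜 := ℝ)).eventually (gt_mem_nhds hδ)
  filter_upwards [hcomp, hinv, eventually_gt_atTop 0] with N h1 h2 h3 n hn
  have hN : (0 : ℝ) < N := by exact_mod_cast h3
  rcases le_or_gt (n : ℝ) (N * T₁) with hnT | hnT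
  · exact (h1 n hnT).trans hηε
  set k : ℕ := ⌊(N : ℝ) * T₁⌋₊ with hk
  have hk0 : (k : ℝ) ≤ N * T₁ := Nat.floor_le (by positivity)
  have hk1 : N * T₁ < k + 1 := Nat.lt_floor_add_one _
  have hkn : k ≤ n := by
    have : (k : ℝ) < n := hk0.trans_lt hnT
    exact_mod_cast this.le
  have hkT : (k : ℝ) / N ≤ T₁ := by rw [div_le_iff₀ hN]; linarith
  have hkT' : ‖x (k / N) - x T₁‖ ≤ η := by
    refine hδx' _ ⟨by positivity, hkT.trans hT₁m.2⟩ _ hT₁m ?_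
    have : T₁ - (N : ℝ)⁻¹ ≤ k / N := by
      rw [le_div_iff₀ hN, sub_mul, inv_mul_cancel₀ hN.ne']; linarith
    rw [abs_lt]; constructor <;> linarith
  have hXk := h1 k hk0
  have hXT : ‖rescaled D (w N k) - x T‖ ≤ 3 * η := by
    have e : rescaled D (w N k) - x T
        = (rescaled D (w N k) - x (k / N)) + (x (k / N) - x T₁) + (x T₁ - x T) := by abel
    rw [e]
    refine norm_add₃_le.trans ?_
    linarith
  have hE : ((w N k).empty.card : ℝ) ≤ N * (3 * (D + 1) * η) := by
    have h4 : ∀ j, (rescaled D (w N k)).2.2 j ≤ 3 * η := by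
      intro j
      have h5 : ‖(rescaled D (w N k) - x T).2.2 j‖ ≤ 3 * η :=
        (norm_le_pi_norm _ j).trans ((norm_snd_le _).trans ((norm_snd_le _).trans hXT))
      have h6 := le_of_abs_le h5
      simp only [Prod.snd_sub, Pi.sub_apply, hx.e_T j, sub_zero] at h6
      exact h6
    have h7 : ∑ j, (rescaled D (w N k)).2.2 j = (w N k).empty.card / N := by
      rw [Config.rescaled_eq, Prod.smul_snd, Prod.smul_snd]
      simp only [Pi.smul_apply, smul_eq_mul, ← Finset.mul_sum, Config.sum_count (hdeg N)]
      rw [div_eq_inv_mul]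
    have h8 := Finset.sum_le_sum fun j (_ : j ∈ Finset.univ) => h4 j
    rw [h7, Finset.sum_const, Finset.card_univ, Fintype.card_fin, nsmul_eq_mul,
      div_le_iff₀ hN] at h8
    push_cast at h8
    linarith
  have hXX : ‖rescaled D (w N n) - rescaled D (w N k)‖ ≤ (2 * D + 1) * (3 * (D + 1) * η) := by
    rw [Config.rescaled_eq, Config.rescaled_eq, ← smul_sub, norm_smul, norm_inv,
      Real.norm_of_nonneg hN.le, inv_mul_le_iff₀ hN]
    refine ((hw N).norm_count_sub_le (hdeg N) hkn).trans ?_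
    calc (2 * (D : ℝ) + 1) * (w N k).empty.card
        ≤ (2 * D + 1) * (N * (3 * (D + 1) * η)) := by gcongr
      _ = _ := by ring
  have hxn : ‖x T - x (n / N)‖ ≤ η := by
    refine htail _ ⟨by rw [le_div_iff₀ hN]; linarith, ?_⟩
    exact div_le_one_of_le₀ (by exact_mod_cast hn) hN.le
  have e : rescaled D (w N n) - x (n / N)
      = (rescaled D (w N n) - rescaled D (w N k)) + (rescaled D (w N k) - x T)
        + (x T - x (n / N)) := by abel
  rw [e]
  refine norm_add₃_le.trans ?_
  rw [← hηB, hB]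
  linarith

/-- The case of vanishing mean degree, in which only `o(N)` half-edges exist. -/
lemma eventually_norm_rescaled_sub_le_of_eq_zero (hx : IsFluidPath p x t T)
    (hp : ∀ j, 0 ≤ p j) (hp_sum : ∑ j, p j = 1) (hl : halfEdgeMass p = 0)
    (hdeg : ∀ N i, deg N i ≤ D)
    (hlim : ∀ j : Fin (D + 1),
      Tendsto (fun N : ℕ => ((Finset.univ.filter fun i => deg N i = (j : ℕ)).card : ℝ) / N)
        atTop (𝓝 (p j)))
    (hw : ∀ N, Config.IsTrajectory (w N)) {ε : ℝ} (hε : 0 < ε) :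
    ∀ᶠ N : ℕ in atTop, ∀ n ≤ N, ‖rescaled D (w N n) - x (n / N)‖ ≤ ε := by
  have h0 : Tendsto (fun N => (rescaled D (w N 0)).2.1) atTop (𝓝 0) := by
    have := (tendsto_rescaled_zero hdeg hlim hw).snd_nhds.fst_nhds
    rwa [hl] at this
  filter_upwards [h0.eventually (gt_mem_nhds (half_pos hε)), eventually_gt_atTop 0]
    with N h1 h2 n hn
  have hN : (0 : ℝ) < N := by exact_mod_cast h2
  have hn' : (n : ℝ) / N ∈ Set.Icc (0 : ℝ) 1 :=
    ⟨by positivity, div_le_one_of_le₀ (by exact_mod_cast hn) hN.le⟩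
  have hxn : x (n / N)
      = (N : ℝ)⁻¹ • ((n : ℝ), 0, fun i => if i = 0 then (N : ℝ) - n else 0) := by
    rw [hx.eq_of_halfEdgeMass_eq_zero hp hp_sum hl hn']
    refine Prod.ext ?_ (Prod.ext ?_ (funext fun i => ?_))
    · simp [div_eq_inv_mul]
    · simp
    · by_cases hi : i = 0
      · simp [hi]; field_simp
      · simp [hi]
  rw [hxn, Config.rescaled_eq, ← smul_sub, norm_smul, norm_inv, Real.norm_of_nonneg hN.le,
    inv_mul_le_iff₀ hN]
  refine ((hw N).norm_count_sub_le_of_le (hdeg N) hn).trans ?_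
  simp only [rescaled] at h1
  rw [div_lt_iff₀ hN] at h1
  linarith

/-- From the grid `{n / N}` to all of `[0, 1]`. -/
lemma tendstoUniformlyOn_of_grid (hx : ContinuousOn x (Set.Icc 0 1))
    (h : ∀ ε : ℝ, 0 < ε → ∀ᶠ N : ℕ in atTop, ∀ n ≤ N, ‖rescaled D (w N n) - x (n / N)‖ ≤ ε) :
    TendstoUniformlyOn (fun (N : ℕ) (r : ℝ) => rescaled D (w N ⌊(N : ℝ) * r⌋₊)) x atTop
      (Set.Icc 0 1) := by
  rw [Metric.tendstoUniformlyOn_iff]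
  intro ε hε
  obtain ⟨δ, hδ, hδx⟩ := Metric.uniformContinuousOn_iff.1
    (isCompact_Icc.uniformContinuousOn_of_continuous hx) (ε / 2) (half_pos hε)
  have hinv : ∀ᶠ N : ℕ in atTop, (N : ℝ)⁻¹ < δ :=
    (tendsto_inv_atTop_nhds_zero_nat (𝕜 := ℝ)).eventually (gt_mem_nhds hδ)
  filter_upwards [h (ε / 2) (half_pos hε), hinv, eventually_gt_atTop 0] with N h1 h2 h3 r hr
  have hN : (0 : ℝ) < N := by exact_mod_cast h3
  set n : ℕ := ⌊(N : ℝ) * r⌋₊ with hn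
  have hn0 : (n : ℝ) ≤ N * r := Nat.floor_le (mul_nonneg hN.le hr.1)
  have hn1 : N * r < n + 1 := Nat.lt_floor_add_one _
  have hnr : (n : ℝ) / N ≤ r := by rw [div_le_iff₀ hN]; linarith
  have hnr' : r - (N : ℝ)⁻¹ < n / N := by
    rw [lt_div_iff₀ hN, sub_mul, inv_mul_cancel₀ hN.ne']; linarith
  have hnN : n ≤ N := by
    have : (n : ℝ) ≤ N := hn0.trans (mul_le_of_le_one_right hN.le hr.2)
    exact_mod_cast this
  have e1 : dist (x r) (x (n / N)) < ε / 2 := by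
    refine hδx r hr _ ⟨by positivity, hnr.trans hr.2⟩ ?_
    rw [Real.dist_eq, abs_lt]
    constructor <;> linarith
  have e2 : dist (x (n / N)) (rescaled D (w N n)) ≤ ε / 2 := by
    rw [dist_comm, dist_eq_norm]
    exact h1 n hnN
  linarith [dist_triangle (x r) (x (n / N)) (rescaled D (w N n))]

end

/-- The centred increments of an observable with bounded increments are bounded. -/
lemma abs_sub_expect_le {α : Type*} [Fintype α] {q : PMF α} {f : α → ℝ} {y K : ℝ}
    (h : ∀ b ∈ q.support, |f b - y| ≤ K) : ∀ b ∈ q.support, |f b - expect q f| ≤ 2 * K := by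
  intro b hb
  have h1 := abs_expect_sub_le (q := q) (f := f) (g := fun _ => y) h
  rw [expect_const] at h1
  have h2 := h b hb
  rw [abs_le] at *
  constructor <;> linarith

end GreedyExploration

theorem mainTheorem3 {D : ℕ} (p : Fin (D + 1) → ℝ) (hp_nonneg : ∀ j, 0 ≤ p j)
    (hp_sum : ∑ j, p j = 1)
    (deg : (N : ℕ) → Fin N → ℕ) (hdeg_le : ∀ N i, deg N i ≤ D)
    (hdeg_lim : ∀ j : Fin (D + 1),
      Tendsto (fun N : ℕ => ((Finset.univ.filter fun i => deg N i = (j : ℕ)).card : ℝ) / N)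
        atTop (𝓝 (p j)))
    {Ω : Type*} [MeasurableSpace Ω] (P : Measure Ω) [IsProbabilityMeasure P]
    (ξ : (N : ℕ) → ℕ → Ω → GreedyExploration.Config (deg N))
    (hξ : ∀ N, GreedyExploration.IsExploration P (ξ N)) :
    ∃ (x : ℝ → GreedyExploration.State D) (t : Fin (D + 1) → ℝ) (T : ℝ),
      GreedyExploration.IsFluidPath p x t T ∧
      (∀ y t' T', GreedyExploration.IsFluidPath p y t' T' →
        Set.EqOn y x (Set.Icc 0 1) ∧ t' = t ∧ T' = T) ∧
      IsGreatest (Set.range t) T ∧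
      (0 < GreedyExploration.halfEdgeMass p →
        IsGreatest (t '' {i | i ≠ 0}) T ∧ ∀ r ∈ Set.Ico 0 T, 0 < (x r).2.1) ∧
      (∀ r ∈ Set.Icc (0 : ℝ) 1,
        x r ∈ GreedyExploration.stateSpace D (GreedyExploration.halfEdgeMass p)) ∧
      ∀ᵐ ω ∂P, TendstoUniformlyOn
        (fun N r => GreedyExploration.rescaledProcess D (ξ N) r ω) x atTop (Set.Icc 0 1) := by
  open GreedyExploration in
  obtain ⟨x, t, T, hx, hT, hgr, hpos, hspace⟩ := exists_fluidPath hp_nonneg hp_sum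
  refine ⟨x, t, T, hx, fun y t' T' hy => hx.unique hy hp_nonneg hp_sum fun hl => (hpos hl).2,
    hgr, hpos, hspace, ?_⟩
  have hchain := fun N => (hξ N).isMarkovChain
  have hnu := ae_eventually_abs_noise_le hchain (f := fun _ a => (a.unpaired.card : ℝ))
    (K := 2 * (2 * D)) fun N a =>
      abs_sub_expect_le fun b hb => Config.abs_unpaired_step_le (hdeg_le N) hb
  have hne : ∀ᵐ ω ∂P, ∀ j : Fin (D + 1), ∀ ε : ℝ, 0 < ε → ∀ᶠ N in atTop, ∀ n ≤ N,
      |noise Config.step (fun a => ((a.emptyOfDeg j).card : ℝ)) (ξ N · ω) n| ≤ ε * N :=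
    ae_all_iff.2 fun j => ae_eventually_abs_noise_le hchain
      (f := fun _ a => ((a.emptyOfDeg j).card : ℝ)) (K := 2 * (D + 1)) fun N a =>
        abs_sub_expect_le fun b hb => Config.abs_emptyOfDeg_step_le (hdeg_le N) hb j
  have htraj : ∀ᵐ ω ∂P, ∀ N, Config.IsTrajectory (ξ N · ω) :=
    ae_all_iff.2 fun N => (hξ N).ae_isTrajectory
  filter_upwards [hnu, hne, htraj] with ω h1 h2 h3
  refine tendstoUniformlyOn_of_grid (w := fun N n => ξ N n ω) hx.cont fun ε hε => ?_
  rcases (halfEdgeMass_nonneg hp_nonneg).eq_or_lt with hl | hl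
  · exact eventually_norm_rescaled_sub_le_of_eq_zero hx hp_nonneg hp_sum hl.symm hdeg_le hdeg_lim
      h3 hε
  · exact eventually_norm_rescaled_sub_le hx hT (hpos hl).2 hdeg_le hdeg_lim h3 h1 h2 hε
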